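/- **Notation.** Let $\mathbb{N}=\{1,2,\dots\}$. Let $E_0(t)=t$, $E_{m+1}(t)=e^{E_m(t)}$; $L_{-1}(t)=e^t$, $L_0(t)=t$, and $L_{m+1}(t)=\ln L_m(t)$ for $t>E_m(0)$, $m\ge 0$; and $\widehat{\mathcal L}_k=(L_{-1},L_0,L_1,\dots,L_k)$. For $z=(z_{-1},\dots,z_k)\in(0,\infty)^{k+2}$ and $\alpha=(\alpha_{-1},\dots,\alpha_k)\in\mathbb{C}^{k+2}$ let $z^\alpha=\prod_{j=-1}^k z_j^{\alpha_j}$, where $s^{a}=\exp(a\ln s)$ for $s>0$, $a\in\mathbb{C}$. For integers $k\ge m\ge -1$, $k\ge 0$, and $\mu\in\mathbb{R}$, let $\mathscr P_m(k,\mu,\mathbb{C}^n)$ be the set of functions $p(z)=\sum_{\alpha\in S}z^\alpha\xi_\alpha$ on $(0,\infty)^{k+2}$, where $S\subset\mathbb{C}^{k+2}$ is finite, $\xi_\alpha\in\mathbb{C}^n$, and every $\alpha\in S$ satisfies $\operatorname{Re}\alpha_j=0$ for $-1\le j<m$ and $\operatorname{Re}\alpha_m=\mu$. Let $\mathscr F_m(k,\mu,\mathbb{C}^n)=\{p\circ\widehat{\mathcal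 L}_k : p\in\mathscr P_m(k,\mu,\mathbb{C}^n)\}$, whose elements are functions on $(E_k(0),\infty)$. Let $m_*\in\mathbb{N}$, let $(\mu_k)_{k\ge1}$ be a strictly increasing sequence of positive numbers with $\mu_k\to\infty$, and let $(n_k)_{k\ge1}$ be a non-decreasing sequence of integers $n_k\ge m_*$. For $g_k\in\mathscr F_{m_*}(n_k,-\mu_k,\mathbb{C}^n)$, the expansion $g(t)\sim\sum_{k=1}^\infty g_k(t)$ means that for every $N\ge1$ there is $\mu>\mu_N$ with $\bigl|g(t)-\sum_{k=1}^N g_k(t)\bigr|=\mathcal O(L_{m_*}(t)^{-\mu})$ as $t\to\infty$. **Assumptions.** Consider $y'=-Ay+G(y)+f(t)$ in $\mathbb{C}^n$, where * $A$ is a complex $n\times n$ matrix all of whose eigenvalues have positive real parts; * $G:\mathbb{C}^n\to\mathbb{C}^n$ is locally Lipschitz, and there are homogeneous polynomials $G_m:\mathbb{C}^n\to\mathbb{C}^n$ of degree $m$, $m\ge2$, such that for every $N\ge2$ there is $\delta>0$ with $\bigl|G(x)-\sum_{m=2}^N G_m(x)\bigr|=\mathcal O(|x|^{N+\delta})$ as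 $x\to0$; * $f$ is continuous on $[T_f,\infty)$ for some $T_f\ge0$, and $f(t)\sim\sum_{k=1}^\infty f_k(t)$ with $f_k\in\mathscr F_{m_*}(n_k,-\mu_k,\mathbb{C}^n)$ for all $k$; * the set $\{\mu_k:k\in\mathbb{N}\}$ is closed under addition; * for some $T_0\ge0$, $y\in C^1((T_0,\infty),\mathbb{C}^n)$ is a solution of the equation on $(T_0,\infty)$, and $y(t)\to0$ as $t\to\infty$. For $p(z)=\sum_{\alpha\in S}z^\alpha\xi_\alpha$ in $\mathscr P_{-1}(k,0,\mathbb{C}^n)$ put $(\mathcal Z_Ap)(z)=\sum_{\alpha\in S}z^\alpha(A+\alpha_{-1}I)^{-1}\xi_\alpha$. This does not depend on the representation of $p$, and $\mathscr P_m(k,\mu,\mathbb{C}^n)\subset\mathscr P_{-1}(k,0,\mathbb{C}^n)$ for $k\ge m\ge0$. **Theorem 9.2.** There exist functions $y_k\in\mathscr F_{m_*}(n_k,-\mu_k,\mathbb{C}^n)$, $k\in\mathbb{N}$, such that $y(t)\sim\sum_{k=1}^\infty y_k(t)$. More specifically, for $m\ge2$ let $\mathcal G_m$ be any $m$-linear mapping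 from $(\mathbb{C}^n)^m$ to $\mathbb{C}^n$ with $\mathcal G_m(x,\dots,x)=G_m(x)$ for all $x$, and let $f_k=p_k\circ\widehat{\mathcal L}_{n_k}$ with $p_k\in\mathscr P_{m_*}(n_k,-\mu_k,\mathbb{C}^n)$ for all $k$. Then the recursion $$q_k=\mathcal Z_A\Bigl(\sum_{m\ge2}\ \sum_{\mu_{j_1}+\dots+\mu_{j_m}=\mu_k}\mathcal G_m(q_{j_1},\dots,q_{j_m})+p_k\Bigr),\qquad k\in\mathbb{N},$$ has a solution $(q_k)_{k\ge1}$, $q_k$ being a function on $(0,\infty)^{n_k+2}$; the sum is finite and involves only indices $j_i<k$, and $q_j$ with $j<k$ is regarded as a function of $z\in(0,\infty)^{n_k+2}$ through the first $n_j+2$ entries of $z$. Every solution $(q_k)$ of the recursion satisfies $q_k\in\mathscr P_{m_*}(n_k,-\mu_k,\mathbb{C}^n)$ for all $k$, and $$y(t)\sim\sum_{k=1}^\infty q_k(\widehat{\mathcal L}_{n_k}(t)).$$ -/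

import Mathlib

open Filter Topology Asymptotics

/-- The space `ℂⁿ` with its Euclidean norm. -/
abbrev CVec (n : ℕ) : Type := EuclideanSpace ℂ (Fin n)

/-- The action `x ↦ M x` of a complex `n × n` matrix on `ℂⁿ`. -/
noncomputable def matVec {n : ℕ} (M : Matrix (Fin n) (Fin n) ℂ) (x : CVec n) : CVec n :=
  Matrix.toEuclideanLin M x

/-! ### Iterated exponentials and logarithms -/

/-- `E₀(t) = t`, `E_{m+1}(t) = exp (E_m(t))`. -/
noncomputable def iterExp : ℕ → ℝ → ℝ
  | 0, t => t
  | m + 1, t => Real.exp (iterExp m t)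

/-- `L₀(t) = t`, `L_{m+1}(t) = ln (L_m(t))`; the values are used only for `t > E_m(0)`, where
`L_m(t) > 0`. -/
noncomputable def iterLog : ℕ → ℝ → ℝ
  | 0, t => t
  | m + 1, t => Real.log (iterLog m t)

/-- The vector `(L₋₁(t), L₀(t), …, L_k(t)) = (eᵗ, t, ln t, …, L_k(t))` of length `k + 2`.
Throughout, the entry with label `j ∈ {-1, …, k}` of a vector of length `k + 2` sits at
position `j + 1`. -/
noncomputable def Lhat (k : ℕ) (t : ℝ) : Fin (k + 2) → ℝ :=
  Fin.cons (Real.exp t) (fun j : Fin (k + 1) => iterLog (j : ℕ) t)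

/-! ### Power functions and the classes `𝒫`, `ℱ` -/

/-- The open orthant `(0,∞)^{k+2}`. -/
def orthant (k : ℕ) : Set (Fin (k + 2) → ℝ) := {z | ∀ i, 0 < z i}

/-- The monomial `z^α = ∏_j z_j^{α_j}`, with complex exponents (principal powers). -/
noncomputable def vpow {k : ℕ} (z : Fin (k + 2) → ℝ) (α : Fin (k + 2) → ℂ) : ℂ :=
  ∏ i, ((z i : ℝ) : ℂ) ^ (α i)

/-- `ℰ(m,k,μ)`: exponents with `Re α_j = 0` for `-1 ≤ j < m` and `Re α_m = μ`. -/
def expSet (m : ℤ) (k : ℕ) (μ : ℝ) : Set (Fin (k + 2) → ℂ) :=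
  {α | ∀ i : Fin (k + 2),
    (((i : ℕ) : ℤ) - 1 < m → (α i).re = 0) ∧ (((i : ℕ) : ℤ) - 1 = m → (α i).re = μ)}

/-- `p(z) = ∑_{α ∈ S} z^α ξ_α` on the orthant, with `S` a finite subset of `ℰ(m,k,μ)`. -/
def IsRep {X : Type*} [AddCommGroup X] [Module ℂ X] (m : ℤ) (k : ℕ) (μ : ℝ)
    (p : (Fin (k + 2) → ℝ) → X) (S : Finset (Fin (k + 2) → ℂ)) (ξ : (Fin (k + 2) → ℂ) → X) :
    Prop :=
  (∀ α ∈ S, α ∈ expSet m k μ) ∧ ∀ z ∈ orthant k, p z = ∑ α ∈ S, vpow z α • ξ α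

/-- `𝒫_m(k,μ,X)`. Its elements are functions on `(0,∞)^{k+2}`; here they are written as functions
on `ℝ^{k+2}` of which only the values on the orthant matter. -/
def PClass (X : Type*) [AddCommGroup X] [Module ℂ X] (m : ℤ) (k : ℕ) (μ : ℝ) :
    Set ((Fin (k + 2) → ℝ) → X) :=
  {p | ∃ (S : Finset (Fin (k + 2) → ℂ)) (ξ : (Fin (k + 2) → ℂ) → X), IsRep m k μ p S ξ}

/-- `ℱ_m(k,μ,X)`: the functions `t ↦ p(L₋₁(t), …, L_k(t))`, `t > E_k(0)`, with
`p ∈ 𝒫_m(k,μ,X)`. Only the values for `t > E_k(0)` matter. -/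
def FClass (X : Type*) [AddCommGroup X] [Module ℂ X] (m : ℤ) (k : ℕ) (μ : ℝ) : Set (ℝ → X) :=
  {g | ∃ p ∈ PClass X m k μ, ∀ t, iterExp k 0 < t → g t = p (Lhat k t)}

/-- The asymptotic expansion `g(t) ∼ ∑_k g_k(t)` with `g_k ∈ ℱ_m(ν_k,-γ_k,X)`: for each `N` there
is `μ > γ_N` with `‖g(t) - ∑_{k ≤ N} g_k(t)‖ = O(L_m(t)^{-μ})` as `t → ∞`.
All sequences are indexed from `0` instead of `1`. -/
def HasLogExpansion {X : Type*} [NormedAddCommGroup X] [NormedSpace ℂ X] (m : ℕ) (γ : ℕ → ℝ)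
    (ν : ℕ → ℕ) (g : ℝ → X) (gs : ℕ → ℝ → X) : Prop :=
  (∀ k, gs k ∈ FClass X (m : ℤ) (ν k) (-γ k)) ∧
  ∀ N : ℕ, ∃ μ : ℝ, γ N < μ ∧
    (fun t => g t - ∑ k ∈ Finset.range (N + 1), gs k t) =O[atTop] (fun t => iterLog m t ^ (-μ))

/-! ### The operator `𝒵_A` -/

open Classical in
/-- `(𝒵_A p)(z) = ∑_{α ∈ S} z^α (A + α₋₁ I)⁻¹ ξ_α` for
`p(z) = ∑_{α ∈ S} z^α ξ_α ∈ 𝒫₋₁(k,0,ℂⁿ)`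
(and `0` by convention for other `p`). The result does not depend on the representation of `p`:
see `ZOp_eq`. -/
noncomputable def ZOp {n : ℕ} (A : Matrix (Fin n) (Fin n) ℂ) (k : ℕ)
    (p : (Fin (k + 2) → ℝ) → CVec n) : (Fin (k + 2) → ℝ) → CVec n :=
  if h : p ∈ PClass (CVec n) (-1) k 0 then
    fun z => ∑ α ∈ h.choose,
      vpow z α • matVec (A + (α 0) • (1 : Matrix (Fin n) (Fin n) ℂ))⁻¹ (h.choose_spec.choose α)
  else 0

/-- The monomial `z ↦ z^α` as a character of the multiplicative monoid `(0,∞)^{k+2}`. -/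
noncomputable def vpowHom {k : ℕ} (α : Fin (k + 2) → ℂ) :
    (Fin (k + 2) → {x : ℝ // 0 < x}) →* ℂ where
  toFun z := vpow (fun i => (z i : ℝ)) α
  map_one' := by simp [vpow]
  map_mul' z w := by
    simp only [vpow, ← Finset.prod_mul_distrib]
    refine Finset.prod_congr rfl fun i _ => ?_
    simp only [Pi.mul_apply, Positive.val_mul, Complex.ofReal_mul]
    exact Complex.mul_cpow_ofReal_nonneg (z i).2.le (w i).2.le _

theorem vpowHom_injective {k : ℕ} : Function.Injective (vpowHom (k := k)) := by
  intro α β h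
  funext i
  have key : ∀ s : ℝ, Complex.exp (s * α i) = Complex.exp (s * β i) := by
    intro s
    have hs := DFunLike.congr_fun h
      (Function.update (1 : Fin (k + 2) → {x : ℝ // 0 < x}) i ⟨Real.exp s, Real.exp_pos s⟩)
    have ev : ∀ γ : Fin (k + 2) → ℂ, vpowHom γ
        (Function.update (1 : Fin (k + 2) → {x : ℝ // 0 < x}) i ⟨Real.exp s, Real.exp_pos s⟩)
        = Complex.exp (s * γ i) := by
      intro γ
      simp only [vpowHom, MonoidHom.coe_mk, OneHom.coe_mk, vpow]
      rw [Finset.prod_eq_single i]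
      · simp only [Function.update_self]
        rw [Complex.ofReal_exp, Complex.cpow_def_of_ne_zero (Complex.exp_ne_zero _),
          ← Complex.ofReal_exp, ← Complex.ofReal_log (Real.exp_pos s).le, Real.log_exp]
      · intro j _ hj
        simp [Function.update_of_ne hj]
      · simp
    rwa [ev, ev] at hs
  have d : ∀ c : ℂ, HasDerivAt (fun s : ℝ => Complex.exp (s * c)) c 0 := by
    intro c
    have h1 : HasDerivAt (fun s : ℝ => (s : ℂ) * c) (1 * c) 0 :=
      (Complex.ofRealCLM.hasDerivAt (x := (0 : ℝ))).mul_const c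
    have h2 := h1.cexp
    simpa using h2
  have e : (fun s : ℝ => Complex.exp (s * α i)) = fun s : ℝ => Complex.exp (s * β i) :=
    funext key
  exact (d (α i)).unique (e ▸ d (β i))

/-- The coefficients of `∑ z^α ξ_α` are determined by its values on the orthant. -/
theorem coeff_eq_zero {n k : ℕ} (S : Finset (Fin (k + 2) → ℂ))
    (ξ : (Fin (k + 2) → ℂ) → CVec n)
    (h : ∀ z ∈ orthant k, ∑ α ∈ S, vpow z α • ξ α = 0) : ∀ α ∈ S, ξ α = 0 := by
  have li : LinearIndependent ℂ
      (fun α : Fin (k + 2) → ℂ => (vpowHom α : (Fin (k + 2) → {x : ℝ // 0 < x}) → ℂ)) :=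
    (linearIndependent_monoidHom (Fin (k + 2) → {x : ℝ // 0 < x}) ℂ).comp _ vpowHom_injective
  intro α hα
  ext i
  refine linearIndependent_iff'.1 li S (fun α => ξ α i) ?_ α hα
  funext z
  have hz := congrArg (fun v : CVec n => v i) (h (fun j => (z j : ℝ)) (fun j => (z j).2))
  simp only [WithLp.ofLp_sum, Finset.sum_apply, PiLp.smul_apply, PiLp.zero_apply,
    smul_eq_mul] at hz
  simp only [Finset.sum_apply, Pi.smul_apply, smul_eq_mul, Pi.zero_apply]
  rw [← hz]
  exact Finset.sum_congr rfl fun β _ => mul_comm _ _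

/-- `𝒵_A p` is computed by its defining formula from any representation of `p`. -/
theorem ZOp_eq {n : ℕ} (A : Matrix (Fin n) (Fin n) ℂ) (k : ℕ) (p : (Fin (k + 2) → ℝ) → CVec n)
    (S : Finset (Fin (k + 2) → ℂ)) (ξ : (Fin (k + 2) → ℂ) → CVec n) (hp : IsRep (-1) k 0 p S ξ)
    (z : Fin (k + 2) → ℝ) :
    ZOp A k p z =
      ∑ α ∈ S, vpow z α • matVec (A + (α 0) • (1 : Matrix (Fin n) (Fin n) ℂ))⁻¹ (ξ α) := by
  classical
  have h : p ∈ PClass (CVec n) (-1) k 0 := ⟨S, ξ, hp⟩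
  rw [ZOp, dif_pos h]
  have hp' := h.choose_spec.choose_spec
  generalize h.choose_spec.choose = η at hp' ⊢
  generalize h.choose = T at hp' ⊢
  have mv0 : ∀ M : Matrix (Fin n) (Fin n) ℂ, matVec M 0 = 0 := fun M => by simp [matVec]
  have ext : ∀ (U : Finset (Fin (k + 2) → ℂ)) (ζ : (Fin (k + 2) → ℂ) → CVec n)
      (F : (Fin (k + 2) → ℂ) → CVec n → CVec n), U ⊆ T ∪ S → (∀ α, F α 0 = 0) →
      ∑ α ∈ U, F α (ζ α) = ∑ α ∈ T ∪ S, F α (if α ∈ U then ζ α else 0) := by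
    intro U ζ F hU hF
    rw [← Finset.sum_subset hU (fun α _ hα => by simp [hα, hF])]
    exact Finset.sum_congr rfl fun α hα => by simp [hα]
  have hc := coeff_eq_zero (T ∪ S)
    (fun α => (if α ∈ T then η α else 0) - (if α ∈ S then ξ α else 0)) (by
      intro z hz
      have e1 := hp'.2 z hz
      have e2 := hp.2 z hz
      rw [ext T η (fun α v => vpow z α • v) Finset.subset_union_left (by simp)] at e1
      rw [ext S ξ (fun α v => vpow z α • v) Finset.subset_union_right (by simp)] at e2
      simp only [smul_sub, Finset.sum_sub_distrib]
      rw [← e1, ← e2, sub_self])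
  rw [ext T η (fun α v => vpow z α • matVec (A + (α 0) • 1)⁻¹ v) Finset.subset_union_left
      (by simp [mv0]),
    ext S ξ (fun α v => vpow z α • matVec (A + (α 0) • 1)⁻¹ v) Finset.subset_union_right
      (by simp [mv0])]
  exact Finset.sum_congr rfl fun α hα => by rw [sub_eq_zero.1 (hc α hα)]

/-! ### The nonlinearity and the recursion -/

/-- `g : ℂⁿ → ℂⁿ` is a homogeneous polynomial of degree `m` (in the complex coordinates). -/
def IsHomogPoly {n : ℕ} (m : ℕ) (g : CVec n → CVec n) : Prop :=
  ∃ P : Fin n → MvPolynomial (Fin n) ℂ,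
    (∀ i, (P i).IsHomogeneous m) ∧ ∀ x i, g x i = MvPolynomial.eval (fun j => x j) (P i)

/-- `G(x) ∼ ∑_{m ≥ 2} G_m(x)` as `x → 0`: for each `N ≥ 2` there is `δ > 0` with
`|G(x) - ∑_{m=2}^N G_m(x)| = O(|x|^{N+δ})`. -/
def HasPowerExpansion {n : ℕ} (G : CVec n → CVec n) (Gs : ℕ → CVec n → CVec n) : Prop :=
  ∀ N : ℕ, 2 ≤ N → ∃ δ : ℝ, 0 < δ ∧
    (fun x => G x - ∑ m ∈ Finset.Icc 2 N, Gs m x) =O[𝓝 0] (fun x => ‖x‖ ^ ((N : ℝ) + δ))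

/-- `S` preserves the addition. -/
def PreservesAdd (S : Set ℝ) : Prop := ∀ x ∈ S, ∀ y ∈ S, x + y ∈ S

/-- The tuples `(j₁, …, j_m)`, `m ≥ 2`, of indices with `μ_{j₁} + ⋯ + μ_{j_m} = μ_k`. -/
def sumTuples (μ : ℕ → ℝ) (k : ℕ) : Set (Σ m : ℕ, (Fin m → ℕ)) :=
  {x | 2 ≤ x.1 ∧ ∑ i, μ (x.2 i) = μ k}

/-- There are finitely many such tuples, so that sums over them are genuine finite sums. -/
theorem sumTuples_finite (μ : ℕ → ℝ) (hpos : ∀ k, 0 < μ k) (hmono : StrictMono μ) (k : ℕ) :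
    (sumTuples μ k).Finite := by
  obtain ⟨M, hM⟩ := exists_nat_gt (μ k / μ 0)
  have hfin : (⋃ m ∈ Finset.range M, (fun j : Fin m → ℕ => (⟨m, j⟩ : Σ m : ℕ, (Fin m → ℕ))) ''
      (Set.Iic (fun _ => k))).Finite :=
    Set.Finite.biUnion (Finset.finite_toSet _) fun m _ => (Set.finite_Iic _).image _
  refine hfin.subset ?_
  rintro ⟨m, j⟩ ⟨-, hj⟩
  simp only at hj
  simp only [Set.mem_iUnion]
  refine ⟨m, ?_, j, ?_, rfl⟩
  · rw [Finset.mem_range]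
    have h1 : (m : ℝ) * μ 0 ≤ μ k := by
      rw [← hj]
      calc (m : ℝ) * μ 0 = ∑ _i : Fin m, μ 0 := by simp
        _ ≤ _ := Finset.sum_le_sum fun i _ => hmono.monotone (Nat.zero_le _)
    have h2 : (m : ℝ) ≤ μ k / μ 0 := (le_div_iff₀ (hpos 0)).2 h1
    exact_mod_cast h2.trans_lt hM
  · intro i
    refine hmono.le_iff_le.1 ?_
    rw [← hj]
    exact Finset.single_le_sum (f := fun i => μ (j i)) (fun i _ => (hpos _).le)
      (Finset.mem_univ i)

/-- The projection `(z₋₁, …, z_k) ↦ (z₋₁, …, z_l)`, `l ≤ k`, through which a function of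
`l + 2` variables is regarded as a function of `k + 2` variables. (If `l > k`, a case that does
not occur in the recursion below, the missing entries are set to `1`.) -/
def projVec {k : ℕ} (l : ℕ) (z : Fin (k + 2) → ℝ) : Fin (l + 2) → ℝ :=
  fun i => if h : (i : ℕ) < k + 2 then z ⟨i, h⟩ else 1

/-- The recursion
`q_k = 𝒵_A (∑_{m ≥ 2} ∑_{μ_{j₁} + ⋯ + μ_{j_m} = μ_k} 𝒢_m(q_{j₁}, …, q_{j_m}) + p_k)` for all `k`,
an identity between functions on `(0,∞)^{ν_k + 2}`. -/
def IsRecursive {n : ℕ} (A : Matrix (Fin n) (Fin n) ℂ)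
    (𝒢 : (m : ℕ) → MultilinearMap ℂ (fun _ : Fin m => CVec n) (CVec n))
    (μ : ℕ → ℝ) (ν : ℕ → ℕ) (p q : (k : ℕ) → (Fin (ν k + 2) → ℝ) → CVec n) : Prop :=
  ∀ k, Set.EqOn (q k)
    (ZOp A (ν k) (fun z =>
      (∑ᶠ x ∈ sumTuples μ k, 𝒢 x.1 (fun i => q (x.2 i) (projVec (ν (x.2 i)) z))) + p k z))
    (orthant (ν k))

/-! ### Iterated logarithms -/

/-! Along `Lhat`, the monomial `z^α` has logarithmic derivative `α₋₁ + O(1/t)`. Since `m_* ≥ 1`, the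
error `1/t` is smaller than every power of `L_{m_*}`. Hence `𝒵_A p`, which divides each coefficient
by `A + α₋₁`, solves `u' = -A u + p` up to a negligible error (`hasDerivAt_ZOp_Lhat`), and each
`q_k` solves the linear equation whose source collects all contributions of weight `μ_k`.

The analytic tool is `isBigO_of_perturbed_ode`: a linear equation with matrix `-A` passes the decay
rate `L_m^{-b}` of its forcing on to the solution, even in the presence of an `o(v)` term. Applied
to `y` itself, with `G(y) = o(y)`, it gives `y = O(L^{-a})` for every `a < μ_0` (indices start at
`0`).

Applied to the remainder `y - ∑_{k ≤ N} q_k`, it yields the induction step `expansion_step`. In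
`G(y)` the solution is replaced by the partial sum of the terms before `N`. As every multilinear
term has degree at least two, the error gains a factor of order `a` close to `μ_0`. Expanding the
multilinear terms at the partial sum gives the recursion sources up to weight `μ_N`, which cancel,
and terms of weight at least `μ_{N+1}` (`sum_tuples_regroup`). What is left decays faster than
`L^{-μ_N}`, and so does the remainder. -/

theorem tendsto_iterLog : ∀ m : ℕ, Tendsto (iterLog m) atTop atTop
  | 0 => tendsto_id
  | m + 1 => Real.tendsto_log_atTop.comp (tendsto_iterLog m)

theorem eventually_one_le_iterLog (m : ℕ) : ∀ᶠ t in atTop, 1 ≤ iterLog m t :=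
  (tendsto_iterLog m).eventually_ge_atTop 1

/-- The derivative of `iterLog m`, far enough to the right. -/
noncomputable def iterLogDeriv : ℕ → ℝ → ℝ
  | 0, _ => 1
  | m + 1, t => iterLogDeriv m t / iterLog m t

theorem hasDerivAt_iterLog (m : ℕ) :
    ∀ᶠ t in atTop, HasDerivAt (iterLog m) (iterLogDeriv m t) t := by
  induction m with
  | zero => exact Eventually.of_forall fun t => hasDerivAt_id t
  | succ m ih =>
    filter_upwards [ih, eventually_one_le_iterLog m] with t h1 h2
    exact h1.log (by linarith)

/-- From index `1` on, the derivative is `1 / (t L_1 ⋯ L_m)`; `L_0' = 1` is excluded. -/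
theorem iterLogDeriv_succ_bound (m : ℕ) :
    ∀ᶠ t in atTop, 0 ≤ iterLogDeriv (m + 1) t ∧ iterLogDeriv (m + 1) t ≤ t⁻¹ := by
  induction m with
  | zero =>
    filter_upwards [eventually_ge_atTop 0] with t ht
    simp [iterLogDeriv, iterLog, ht]
  | succ m ih =>
    filter_upwards [ih, eventually_one_le_iterLog (m + 1)] with t h1 h2
    refine ⟨div_nonneg h1.1 (by linarith), ?_⟩
    exact (div_le_self h1.1 h2).trans h1.2

theorem iterLog_isLittleO {m j : ℕ} (h : m < j) : iterLog j =o[atTop] iterLog m := by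
  induction j, h using Nat.le_induction with
  | base => exact Real.isLittleO_log_id_atTop.comp_tendsto (tendsto_iterLog m)
  | succ j _ ih =>
    exact (Real.isLittleO_log_id_atTop.comp_tendsto (tendsto_iterLog j)).trans ih

/-- Turns comparisons of powers of `L_m` into linear comparisons with `L_{m+1}`. -/
theorem iterLog_rpow_eq (m : ℕ) (a : ℝ) :
    ∀ᶠ t in atTop, iterLog m t ^ a = Real.exp (a * iterLog (m + 1) t) := by
  filter_upwards [eventually_one_le_iterLog m] with t ht
  rw [Real.rpow_def_of_pos (by linarith), mul_comm]; rfl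

theorem iterLog_rpow_isBigO (m : ℕ) {a b : ℝ} (h : a ≤ b) :
    (fun t => iterLog m t ^ a) =O[atTop] (fun t => iterLog m t ^ b) := by
  refine IsBigO.of_bound 1 ?_
  filter_upwards [eventually_one_le_iterLog m] with t ht
  have h0 : 0 ≤ iterLog m t := by linarith
  rw [Real.norm_of_nonneg (Real.rpow_nonneg h0 _), Real.norm_of_nonneg (Real.rpow_nonneg h0 _),
    one_mul]
  exact Real.rpow_le_rpow_of_exponent_le ht h

theorem iterLog_rpow_mul (m : ℕ) (a b : ℝ) :
    (fun t => iterLog m t ^ a * iterLog m t ^ b) =ᶠ[atTop] (fun t => iterLog m t ^ (a + b)) := by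
  filter_upwards [eventually_one_le_iterLog m] with t ht
  rw [Real.rpow_add (by linarith)]

/-- Every negative power of an iterated logarithm decays slower than `1 / t`. -/
theorem inv_isBigO_iterLog_rpow {m : ℕ} (hm : 1 ≤ m) (M : ℝ) :
    (fun t : ℝ => t⁻¹) =O[atTop] (fun t => iterLog m t ^ (-M)) := by
  refine IsBigO.of_bound 1 ?_
  -- After taking logarithms the claim is `M L_{m+1} ≤ L_1` eventually, which holds because `m ≥ 1`
  -- makes `L_{m+1} = o(L_1)`.
  have h := (iterLog_isLittleO (show 1 < m + 1 by omega)).bound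
    (c := (|M| + 1)⁻¹) (by positivity)
  filter_upwards [h, iterLog_rpow_eq m (-M), eventually_gt_atTop 0,
    eventually_one_le_iterLog (m + 1), eventually_one_le_iterLog 1] with t h1 h2 ht h3 h4
  rw [Real.norm_of_nonneg (by linarith), Real.norm_of_nonneg (by linarith),
    inv_mul_eq_div, le_div_iff₀ (by positivity)] at h1
  have e : t⁻¹ = Real.exp (-iterLog 1 t) := by
    rw [Real.exp_neg, show iterLog 1 t = Real.log t from rfl, Real.exp_log ht]
  rw [h2, e, Real.norm_of_nonneg (Real.exp_pos _).le, Real.norm_of_nonneg (Real.exp_pos _).le,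
    one_mul, Real.exp_le_exp]
  nlinarith [le_abs_self M]

/-- Powers of iterated logarithms vary slowly. -/
theorem iterLog_rpow_slow (m : ℕ) (a : ℝ) :
    ∃ φ' : ℝ → ℝ, ∀ r > 0, ∀ᶠ t in atTop, 0 < iterLog m t ^ a ∧
      HasDerivAt (fun t => iterLog m t ^ a) (φ' t) t ∧ -(r * iterLog m t ^ a) ≤ φ' t := by
  refine ⟨fun t => iterLogDeriv m t * a * iterLog m t ^ (a - 1), fun r hr => ?_⟩
  filter_upwards [eventually_one_le_iterLog m, hasDerivAt_iterLog m, iterLogDeriv_succ_bound m,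
    eventually_gt_atTop (|a| / r), eventually_gt_atTop 0] with t h1 h2 h3 h4 h5
  have hp : 0 < iterLog m t ^ a := Real.rpow_pos_of_pos (by linarith) _
  refine ⟨hp, h2.rpow_const (Or.inl (by linarith)), ?_⟩
  -- The logarithmic derivative of `L_m^a` is `a L_{m+1}'`, hence at most `|a| / t` in modulus.
  have e : iterLogDeriv m t * a * iterLog m t ^ (a - 1)
      = iterLogDeriv (m + 1) t * a * iterLog m t ^ a := by
    rw [Real.rpow_sub_one (by linarith), iterLogDeriv]; ring
  rw [e, ← neg_mul]
  refine mul_le_mul_of_nonneg_right ?_ hp.le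
  have h6 : t⁻¹ * |a| ≤ r := by
    rw [inv_mul_eq_div, div_le_iff₀ h5]
    rw [div_lt_iff₀ hr] at h4
    linarith
  have h7 : iterLogDeriv (m + 1) t * |a| ≤ t⁻¹ * |a| :=
    mul_le_mul_of_nonneg_right h3.2 (abs_nonneg a)
  have h8 := mul_le_mul_of_nonneg_left (neg_abs_le a) h3.1
  linarith

/-! ### Monomials along the vector of iterated logarithms -/

theorem Lhat_zero (k : ℕ) (t : ℝ) : Lhat k t 0 = Real.exp t := rfl

theorem Lhat_succ (k : ℕ) (t : ℝ) (j : Fin (k + 1)) : Lhat k t j.succ = iterLog j t := rfl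

theorem Lhat_mem_orthant (k : ℕ) : ∀ᶠ t in atTop, Lhat k t ∈ orthant k := by
  have h : ∀ᶠ t in atTop, ∀ j : Fin (k + 1), 1 ≤ iterLog j t :=
    eventually_all.2 fun j => eventually_one_le_iterLog j
  filter_upwards [h] with t ht i
  refine Fin.cases ?_ (fun j => ?_) i
  · exact Real.exp_pos t
  · exact one_pos.trans_le (ht j)

theorem projVec_mem_orthant {k : ℕ} (l : ℕ) {z : Fin (k + 2) → ℝ} (hz : z ∈ orthant k) :
    projVec l z ∈ orthant l := by
  intro i
  unfold projVec
  split_ifs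
  · exact hz _
  · exact one_pos

theorem projVec_Lhat {k l : ℕ} (h : l ≤ k) (t : ℝ) : projVec l (Lhat k t) = Lhat l t := by
  funext i
  refine Fin.cases ?_ (fun j => ?_) i
  · rfl
  · have hj : (j.succ : ℕ) < k + 2 := by have := j.succ.2; omega
    rw [projVec, dif_pos hj, Lhat_succ]
    rfl

/-- The exponent of `z^α` along `z = Lhat k t`. -/
noncomputable def logPhase {k : ℕ} (α : Fin (k + 2) → ℂ) (t : ℝ) : ℂ :=
  α 0 * t + ∑ j : Fin (k + 1), α j.succ * (iterLog (j + 1) t : ℂ)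

theorem vpow_Lhat (k : ℕ) : ∀ᶠ t in atTop, ∀ α : Fin (k + 2) → ℂ,
    vpow (Lhat k t) α = Complex.exp (logPhase α t) := by
  filter_upwards [Lhat_mem_orthant k] with t ht α
  have key : ∀ i, ((Lhat k t i : ℝ) : ℂ) ^ (α i) = Complex.exp (α i * Real.log (Lhat k t i)) := by
    intro i
    rw [Complex.cpow_def_of_ne_zero (by exact_mod_cast (ht i).ne'), Complex.ofReal_log (ht i).le,
      mul_comm]
  rw [vpow, Finset.prod_congr rfl fun i _ => key i, ← Complex.exp_sum, Fin.sum_univ_succ, logPhase,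
    Lhat_zero, Real.log_exp]
  rfl

/-- The deviation of the logarithmic derivative of `z^α` along `Lhat k` from `α₋₁`. -/
noncomputable def logPhaseCorr {k : ℕ} (α : Fin (k + 2) → ℂ) (t : ℝ) : ℂ :=
  ∑ j : Fin (k + 1), α j.succ * (iterLogDeriv (j + 1) t : ℂ)

theorem eventually_mem_nhds_of_atTop {P : ℝ → Prop} (h : ∀ᶠ t in atTop, P t) :
    ∀ᶠ t in atTop, ∀ᶠ s in 𝓝 t, P s := by
  obtain ⟨T, hT⟩ := eventually_atTop.1 h
  filter_upwards [eventually_gt_atTop T] with t ht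
  filter_upwards [Ioi_mem_nhds ht] with s hs using hT s (le_of_lt hs)

theorem hasDerivAt_vpow_Lhat {k : ℕ} (α : Fin (k + 2) → ℂ) : ∀ᶠ t in atTop,
    HasDerivAt (fun t => vpow (Lhat k t) α)
      (vpow (Lhat k t) α * (α 0 + logPhaseCorr α t)) t := by
  have h : ∀ᶠ t in atTop, ∀ j : Fin (k + 1),
      HasDerivAt (iterLog (j + 1)) (iterLogDeriv (j + 1) t) t :=
    eventually_all.2 fun j => hasDerivAt_iterLog _
  filter_upwards [h, vpow_Lhat k, eventually_mem_nhds_of_atTop (vpow_Lhat k)] with t h1 h2 h3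
  have hd : HasDerivAt (logPhase α) (α 0 + logPhaseCorr α t) t := by
    refine HasDerivAt.add ?_ (HasDerivAt.fun_sum fun j _ => ?_)
    · simpa using (Complex.ofRealCLM.hasDerivAt (x := t)).const_mul (α 0)
    · exact (h1 j).ofReal_comp.const_mul _
  rw [h2]
  refine hd.cexp.congr_of_eventuallyEq ?_
  filter_upwards [h3] with s hs using hs α

theorem logPhaseCorr_isBigO {k : ℕ} (α : Fin (k + 2) → ℂ) :
    logPhaseCorr α =O[atTop] (fun t : ℝ => t⁻¹) := by
  have : logPhaseCorr α = fun t => ∑ j : Fin (k + 1), α j.succ * (iterLogDeriv (j + 1) t : ℂ) := rfl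
  rw [this]
  refine IsBigO.fun_sum fun j _ => IsBigO.const_mul_left ?_ _
  refine IsBigO.of_bound 1 ?_
  filter_upwards [iterLogDeriv_succ_bound j] with t ht
  rw [Complex.norm_real, one_mul]
  exact abs_le_abs_of_nonneg ht.1 ht.2

/-- The modulus is the exponential of `∑ Re α_j L_{j+1}`. Entries before `m` contribute nothing,
entry `m` contributes `a L_{m+1}`, and later entries, whose real parts are arbitrary, contribute
`o(L_{m+1})`. The latter cost the `ε`. -/
theorem vpow_Lhat_isBigO {m k : ℕ} (hmk : m ≤ k) {a : ℝ} {α : Fin (k + 2) → ℂ}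
    (hα : α ∈ expSet m k a) {ε : ℝ} (hε : 0 < ε) :
    (fun t => vpow (Lhat k t) α) =O[atTop] (fun t => iterLog m t ^ (a + ε)) := by
  have h0 : (α 0).re = 0 := (hα 0).1 (by simp; omega)
  have hsum : (fun t => ∑ j : Fin (k + 1), ((α j.succ).re - if (j : ℕ) = m then a else 0) *
      iterLog (j + 1) t) =o[atTop] iterLog (m + 1) := by
    refine IsLittleO.fun_sum fun j _ => ?_
    rcases lt_trichotomy (j : ℕ) m with hj | hj | hj
    · have : (α j.succ).re = 0 := (hα j.succ).1 (by simp; omega)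
      simp [this, hj.ne]
    · have : (α j.succ).re = a := (hα j.succ).2 (by simp; omega)
      simp [this, hj]
    · exact (iterLog_isLittleO (by omega)).const_mul_left _
  refine IsBigO.of_bound 1 ?_
  filter_upwards [hsum.bound hε, vpow_Lhat k, iterLog_rpow_eq m (a + ε),
    eventually_one_le_iterLog (m + 1)] with t h1 h2 h3 h4
  rw [h2, h3, Complex.norm_exp, Real.norm_of_nonneg (Real.exp_pos _).le, one_mul, Real.exp_le_exp]
  rw [Real.norm_of_nonneg (by linarith : 0 ≤ iterLog (m + 1) t)] at h1
  have h5 := (le_abs_self _).trans h1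
  have e : (logPhase α t).re = ∑ j : Fin (k + 1), (α j.succ).re * iterLog (j + 1) t := by
    simp [logPhase, h0]
  have e2 : ∑ j : Fin (k + 1), (if (j : ℕ) = m then a else 0) * iterLog (j + 1) t
      = a * iterLog (m + 1) t := by
    rw [Finset.sum_eq_single (⟨m, by omega⟩ : Fin (k + 1))]
    · simp
    · intro j _ hj
      rw [if_neg (fun h => hj (Fin.ext h)), zero_mul]
    · simp
  simp only [sub_mul, Finset.sum_sub_distrib] at h5
  rw [e2] at h5
  rw [e]
  linarith

/-! ### Linear equations with slowly decaying forcing -/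

/-- With the integrating factor `e^{ls}`, the function `c e^{Re l s} φ(s)` is a barrier: slow
variation of `φ` makes it grow at least at the rate `(Re l / 2) c e^{Re l s} φ(s)`. The constant `c
= (1 + 2 / Re l) K` dominates both the initial value (`c ≥ K`) and the forcing (`(Re l / 2) c ≥ K`).
-/
theorem norm_le_of_scalar_ode {E : Type*} [NormedAddCommGroup E] [NormedSpace ℂ E] {l : ℂ}
    (hl : 0 < l.re) {T t K : ℝ} (hK : 0 ≤ K) {φ φ' : ℝ → ℝ} {v h : ℝ → E}
    (hφ : ∀ s ∈ Set.Icc T t, 0 < φ s ∧ HasDerivAt φ (φ' s) s ∧ -(l.re / 2 * φ s) ≤ φ' s)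
    (hv : ∀ s ∈ Set.Icc T t, HasDerivAt v (-(l • v s) + h s) s)
    (hh : ∀ s ∈ Set.Icc T t, ‖h s‖ ≤ K * φ s) (hvT : ‖v T‖ ≤ K * φ T) :
    ∀ s ∈ Set.Icc T t, ‖v s‖ ≤ (1 + 2 / l.re) * K * φ s := by
  set c : ℝ := (1 + 2 / l.re) * K with hc
  have hKc : K ≤ c := by
    rw [hc]; exact le_mul_of_one_le_left hK (by have : 0 < 2 / l.re := by positivity
                                                linarith)
  have hKc2 : K ≤ l.re / 2 * c := by
    have : l.re / 2 * c = K + l.re / 2 * K := by rw [hc]; field_simp; ring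
    rw [this]; nlinarith
  have hd : ∀ s ∈ Set.Icc T t, HasDerivAt (fun s : ℝ => Complex.exp (l * s) • v s)
      (Complex.exp (l * s) • h s) s := by
    intro s hs
    have h1 : HasDerivAt (fun s : ℝ => Complex.exp (l * s)) (Complex.exp (l * s) * l) s := by
      have := ((Complex.ofRealCLM.hasDerivAt (x := s)).const_mul l).cexp
      simpa using this
    refine (h1.fun_smul (hv s hs)).congr_deriv ?_
    rw [smul_add, smul_neg, smul_smul]; abel
  have hB : ∀ s ∈ Set.Icc T t, HasDerivAt (fun s : ℝ => c * (Real.exp (l.re * s) * φ s))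
      (c * (Real.exp (l.re * s) * l.re * φ s + Real.exp (l.re * s) * φ' s)) s := by
    intro s hs
    have h1 : HasDerivAt (fun s : ℝ => Real.exp (l.re * s)) (Real.exp (l.re * s) * l.re) s := by
      simpa using ((hasDerivAt_id s).const_mul l.re).exp
    exact (h1.mul (hφ s hs).2.1).const_mul c
  have hn : ∀ s : ℝ, ‖Complex.exp (l * s)‖ = Real.exp (l.re * s) := by
    intro s; rw [Complex.norm_exp]; simp
  intro s hs
  have hTt : T ≤ t := hs.1.trans hs.2
  have key := image_norm_le_of_norm_deriv_right_le_deriv_boundary'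
    (f := fun s : ℝ => Complex.exp (l * s) • v s) (a := T) (b := t)
    (fun x hx => (hd x hx).continuousAt.continuousWithinAt)
    (fun x hx => (hd x ⟨hx.1, hx.2.le⟩).hasDerivWithinAt)
    (B := fun s : ℝ => c * (Real.exp (l.re * s) * φ s)) (by
      rw [norm_smul, hn]
      have h1 := (hφ T ⟨le_rfl, hTt⟩).1
      have : K * φ T ≤ c * φ T := mul_le_mul_of_nonneg_right hKc h1.le
      nlinarith [Real.exp_pos (l.re * T)])
    (fun x hx => (hB x hx).continuousAt.continuousWithinAt)
    (fun x hx => (hB x ⟨hx.1, hx.2.le⟩).hasDerivWithinAt)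
    (by
      intro x hx
      obtain ⟨h1, -, h2⟩ := hφ x ⟨hx.1, hx.2.le⟩
      have h3 := hh x ⟨hx.1, hx.2.le⟩
      rw [norm_smul, hn]
      have e : c * (Real.exp (l.re * x) * l.re * φ x + Real.exp (l.re * x) * φ' x)
          = Real.exp (l.re * x) * (c * (l.re * φ x + φ' x)) := by ring
      rw [e]
      refine mul_le_mul_of_nonneg_left (h3.trans ?_) (Real.exp_pos _).le
      have h4 : K * φ x ≤ l.re / 2 * c * φ x := mul_le_mul_of_nonneg_right hKc2 h1.le
      have h5 : c * (l.re / 2 * φ x) ≤ c * (l.re * φ x + φ' x) :=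
        mul_le_mul_of_nonneg_left (by linarith) (hK.trans hKc)
      linarith)
    hs
  simp only [norm_smul, hn] at key
  have := Real.exp_pos (l.re * s)
  refine le_of_mul_le_mul_left ?_ this
  linarith

open Polynomial in
/-- A solution `v` of `v' = -B v + R` is controlled by `R`, by its initial value, and by
`∏ (B - l) v`, for any finite family of numbers `l` with positive real parts. -/
theorem norm_le_of_linear_ode {E : Type*} [NormedAddCommGroup E] [NormedSpace ℂ E]
    (B : E →L[ℂ] E) (S : Multiset ℂ) : (∀ l ∈ S, 0 < l.re) →
    ∃ r > 0, ∃ b > 0, ∀ (T t K : ℝ) (φ φ' : ℝ → ℝ) (v R : ℝ → E), 0 ≤ K →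
      (∀ s ∈ Set.Icc T t, 0 < φ s ∧ HasDerivAt φ (φ' s) s ∧ -(r * φ s) ≤ φ' s) →
      (∀ s ∈ Set.Icc T t, HasDerivAt v (-(B (v s)) + R s) s) →
      (∀ s ∈ Set.Icc T t, ‖R s‖ ≤ K * φ s) → ‖v T‖ ≤ K * φ T →
      (∀ s ∈ Set.Icc T t, ‖aeval B (S.map fun l => X - C l).prod (v s)‖ ≤ K * φ s) →
      ∀ s ∈ Set.Icc T t, ‖v s‖ ≤ b * K * φ s := by
  induction S using Multiset.induction_on with
  | empty =>
    intro _
    refine ⟨1, one_pos, 1, one_pos, fun T t K φ φ' v R _ _ _ _ _ h s hs => ?_⟩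
    simpa only [Multiset.map_zero, Multiset.prod_zero, map_one, one_mul,
      one_apply_eq_self] using h s hs
  | cons l S ih =>
    intro hS
    obtain ⟨r, hr, C₀, hC₀, ih⟩ := ih fun x hx => hS x (Multiset.mem_cons_of_mem hx)
    have hl : 0 < l.re := hS l (Multiset.mem_cons_self l S)
    -- `w = (B - l) v` solves the same equation with forcing `(B - l) R`, and the product over the
    -- remaining numbers applied to `w` is the full product applied to `v`. So the induction
    -- hypothesis bounds `w`. The factor `c` pays for applying `B - l` to the data.
    set D : E →L[ℂ] E := B - algebraMap ℂ (E →L[ℂ] E) l with hD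
    set c : ℝ := max 1 ‖D‖ with hc
    have hc1 : 1 ≤ c := le_max_left _ _
    have hcD : ‖D‖ ≤ c := le_max_right _ _
    have hDv : ∀ x, D x = B x - l • x := fun x => by
      simp [hD, Algebra.algebraMap_eq_smul_one]
    refine ⟨min r (l.re / 2), lt_min hr (by positivity),
      (1 + 2 / l.re) * (C₀ * c + 1), by positivity, ?_⟩
    intro T t K φ φ' v R hK hφ hv hR hvT hP
    have hφpos : ∀ s ∈ Set.Icc T t, 0 < φ s := fun s hs => (hφ s hs).1
    have hw : ∀ s ∈ Set.Icc T t, ‖D (v s)‖ ≤ C₀ * (c * K) * φ s := by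
      refine ih T t (c * K) φ φ' (fun s => D (v s)) (fun s => D (R s)) (by positivity) ?_ ?_ ?_ ?_ ?_
      · intro s hs
        obtain ⟨h1, h2, h3⟩ := hφ s hs
        exact ⟨h1, h2, le_trans (neg_le_neg (mul_le_mul_of_nonneg_right (min_le_left _ _) h1.le)) h3⟩
      · intro s hs
        have h1 := (D.restrictScalars ℝ).hasFDerivAt.comp_hasDerivAt s (hv s hs)
        refine h1.congr_deriv ?_
        change D _ = _
        simp only [map_add, map_neg, hDv, map_sub, map_smul, smul_add, smul_neg]
        abel
      · intro s hs
        calc ‖D (R s)‖ ≤ ‖D‖ * ‖R s‖ := D.le_opNorm _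
          _ ≤ c * (K * φ s) := mul_le_mul hcD (hR s hs) (norm_nonneg _) (by positivity)
          _ = c * K * φ s := by ring
      · have : 0 ≤ K * φ T := (norm_nonneg _).trans hvT
        calc ‖D (v T)‖ ≤ ‖D‖ * ‖v T‖ := D.le_opNorm _
          _ ≤ c * (K * φ T) := mul_le_mul hcD hvT (norm_nonneg _) (by positivity)
          _ = c * K * φ T := by ring
      · intro s hs
        have h1 := hP s hs
        rw [Multiset.map_cons, Multiset.prod_cons, mul_comm, map_mul] at h1
        have e : aeval B (X - C l) = D := by simp [hD]
        rw [e] at h1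
        refine h1.trans ?_
        have : 0 ≤ K * φ s := mul_nonneg hK (hφpos s hs).le
        nlinarith
    -- With `w = (B - l) v` under control, `B v = l v + w` turns the equation into the scalar one
    -- `v' = -l v + (-w + R)`.
    have hfin := norm_le_of_scalar_ode (T := T) (t := t) (K := (C₀ * c + 1) * K) (φ := φ) (φ' := φ')
      (v := v) (h := fun s => -(D (v s)) + R s) hl (by positivity)
      (fun s hs => ?_) (fun s hs => ?_) (fun s hs => ?_) ?_
    · intro s hs
      calc ‖v s‖ ≤ _ := hfin s hs
        _ = _ := by ring
    · obtain ⟨h1, h2, h3⟩ := hφ s hs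
      exact ⟨h1, h2, le_trans (neg_le_neg (mul_le_mul_of_nonneg_right (min_le_right _ _) h1.le)) h3⟩
    · convert hv s hs using 1
      rw [hDv]; abel
    · calc ‖-(D (v s)) + R s‖ ≤ ‖-(D (v s))‖ + ‖R s‖ := norm_add_le _ _
        _ ≤ C₀ * (c * K) * φ s + K * φ s := by
          rw [norm_neg]; exact add_le_add (hw s hs) (hR s hs)
        _ = _ := by ring
    · have h1 : 0 ≤ K * φ T := (norm_nonneg _).trans hvT
      have h2 : 0 ≤ C₀ * c := by positivity
      nlinarith

theorem matVec_eq_toEuclideanCLM {n : ℕ} (A : Matrix (Fin n) (Fin n) ℂ) (x : CVec n) :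
    matVec A x = Matrix.toEuclideanCLM (𝕜 := ℂ) A x := rfl

open Polynomial in
/-- If all eigenvalues of `A` have positive real parts and `φ` varies slowly, then a solution of
`v' = -A v + H + R` with `H = o(v)` and `R = O(φ)` is `O(φ)`. -/
theorem isBigO_of_perturbed_ode {n : ℕ} (A : Matrix (Fin n) (Fin n) ℂ)
    (hA : ∀ l ∈ spectrum ℂ A, 0 < l.re) {φ φ' : ℝ → ℝ}
    (hφ : ∀ r > 0, ∀ᶠ t in atTop, 0 < φ t ∧ HasDerivAt φ (φ' t) t ∧ -(r * φ t) ≤ φ' t)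
    {v H R : ℝ → CVec n}
    (hv : ∀ᶠ t in atTop, HasDerivAt v (-(matVec A (v t)) + H t + R t) t)
    (hH : H =o[atTop] v) (hR : R =O[atTop] φ) : v =O[atTop] φ := by
  obtain ⟨r, hr, C₀, hC₀, key⟩ := norm_le_of_linear_ode (Matrix.toEuclideanCLM (𝕜 := ℂ) A)
    A.charpoly.roots (fun l hl => hA l (Matrix.mem_spectrum_iff_isRoot_charpoly.2
      (isRoot_of_mem_roots hl)))
  -- For the roots of the characteristic polynomial the product vanishes by Cayley–Hamilton, so no
  -- bound on it is required and no matrix exponential is needed.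
  have hCH : aeval (Matrix.toEuclideanCLM (𝕜 := ℂ) A)
      (A.charpoly.roots.map fun l => X - C l).prod = 0 := by
    rw [← (IsAlgClosed.splits A.charpoly).eq_prod_roots_of_monic A.charpoly_monic,
      aeval_algHom_apply, A.aeval_self_charpoly, map_zero]
  obtain ⟨c, hc, hRc⟩ := hR.exists_pos
  obtain ⟨T, hT⟩ := eventually_atTop.1 ((hφ r hr).and (hv.and
    ((hH.bound (c := 1 / (2 * C₀)) (by positivity)).and hRc.bound)))
  set M₀ : ℝ := ‖v T‖ / φ T with hM₀
  have hφT : 0 < φ T := (hT T le_rfl).1.1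
  have hM₀n : 0 ≤ M₀ := by positivity
  refine IsBigO.of_bound (2 * C₀ * (c + M₀)) ?_
  filter_upwards [eventually_ge_atTop T] with t ht
  have hpos : ∀ s ∈ Set.Icc T t, 0 < φ s := fun s hs => (hT s hs.1).1.1
  have hcont : ContinuousOn (fun s => ‖v s‖ / φ s) (Set.Icc T t) := fun s hs =>
    ((hT s hs.1).2.1.continuousAt.norm.div (hT s hs.1).1.2.1.continuousAt
      (hpos s hs).ne').continuousWithinAt
  -- Let `M` be the maximum of `‖v‖ / φ` on `[T, t]`. The perturbation `H` contributes at most `M /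
  -- (2 C₀)` to the forcing constant, so the linear estimate at the maximum point reads `M ≤ M / 2 +
  -- C₀ (c + M₀)`, a bound independent of `t`.
  obtain ⟨s₀, hs₀, hmax⟩ := isCompact_Icc.exists_isMaxOn ⟨T, le_rfl, ht⟩ hcont
  set M : ℝ := ‖v s₀‖ / φ s₀ with hM
  have hMn : 0 ≤ M := div_nonneg (norm_nonneg _) (hpos s₀ hs₀).le
  have hvM : ∀ s ∈ Set.Icc T t, ‖v s‖ ≤ M * φ s := fun s hs =>
    (div_le_iff₀ (hpos s hs)).1 (hmax hs)
  have h1 := key T t (M / (2 * C₀) + c + M₀) φ φ' v (fun s => H s + R s) (by positivity)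
    (fun s hs => (hT s hs.1).1)
    (fun s hs => by
      have := (hT s hs.1).2.1
      rwa [add_assoc] at this)
    (fun s hs => by
      obtain ⟨-, -, h2, h3⟩ := hT s hs.1
      rw [Real.norm_of_nonneg (hpos s hs).le] at h3
      have h4 : 1 / (2 * C₀) * ‖v s‖ ≤ 1 / (2 * C₀) * (M * φ s) :=
        mul_le_mul_of_nonneg_left (hvM s hs) (by positivity)
      have h5 := mul_nonneg hM₀n (hpos s hs).le
      calc ‖H s + R s‖ ≤ ‖H s‖ + ‖R s‖ := norm_add_le _ _
        _ ≤ 1 / (2 * C₀) * (M * φ s) + c * φ s := by linarith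
        _ ≤ 1 / (2 * C₀) * (M * φ s) + c * φ s + M₀ * φ s := by linarith
        _ = _ := by ring)
    (by
      have h2 : ‖v T‖ = M₀ * φ T := by rw [hM₀]; field_simp
      rw [h2]
      refine mul_le_mul_of_nonneg_right ?_ hφT.le
      have : 0 ≤ M / (2 * C₀) := by positivity
      linarith)
    (fun s hs => by
      rw [hCH]
      have := (hpos s hs).le
      simp only [zero_apply, norm_zero]
      positivity) s₀ hs₀
  have h2 : M ≤ C₀ * (M / (2 * C₀) + c + M₀) := (div_le_iff₀ (hpos s₀ hs₀)).2 h1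
  have h3 : C₀ * (M / (2 * C₀) + c + M₀) = M / 2 + C₀ * (c + M₀) := by field_simp; ring
  rw [Real.norm_of_nonneg (hpos t ⟨ht, le_rfl⟩).le]
  refine (hvM t ⟨ht, le_rfl⟩).trans (mul_le_mul_of_nonneg_right ?_ (hpos t ⟨ht, le_rfl⟩).le)
  linarith

/-! ### Closure properties of the classes `𝒫` -/

section PClass

variable {X Y : Type*} [AddCommGroup X] [Module ℂ X] [AddCommGroup Y] [Module ℂ Y]
  {m : ℤ} {k : ℕ} {a : ℝ}

/-- Permits representations with repeated exponents: coefficients of equal exponents are merged.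
This spares the closure properties below any disjointness argument. -/
theorem mem_PClass_of_sum {ι : Type*} {p : (Fin (k + 2) → ℝ) → X} (s : Finset ι)
    (α : ι → Fin (k + 2) → ℂ) (ξ : ι → X) (hα : ∀ i ∈ s, α i ∈ expSet m k a)
    (hp : ∀ z ∈ orthant k, p z = ∑ i ∈ s, vpow z (α i) • ξ i) : p ∈ PClass X m k a := by
  classical
  refine ⟨s.image α, fun β => ∑ i ∈ s with α i = β, ξ i, fun β hβ => ?_, fun z hz => ?_⟩
  · obtain ⟨i, hi, rfl⟩ := Finset.mem_image.1 hβ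
    exact hα i hi
  · rw [hp z hz, ← Finset.sum_fiberwise_of_maps_to (t := s.image α) (g := α)
      (fun i hi => Finset.mem_image_of_mem α hi)]
    refine Finset.sum_congr rfl fun β _ => ?_
    rw [Finset.smul_sum]
    refine Finset.sum_congr rfl fun i hi => ?_
    rw [(Finset.mem_filter.1 hi).2]

theorem zero_mem_PClass : (fun _ => (0 : X)) ∈ PClass X m k a :=
  ⟨∅, 0, by simp, by simp⟩

theorem add_mem_PClass {p q : (Fin (k + 2) → ℝ) → X} (hp : p ∈ PClass X m k a)
    (hq : q ∈ PClass X m k a) : (fun z => p z + q z) ∈ PClass X m k a := by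
  obtain ⟨S, ξ, hS, hp⟩ := hp
  obtain ⟨T, η, hT, hq⟩ := hq
  refine mem_PClass_of_sum (S.disjSum T) (Sum.elim id id) (Sum.elim ξ η) ?_ fun z hz => ?_
  · rintro (i | i) hi
    · exact hS i (by simpa using hi)
    · exact hT i (by simpa using hi)
  · rw [hp z hz, hq z hz, Finset.sum_disjSum]; rfl

theorem sum_mem_PClass {ι : Type*} (s : Finset ι) (p : ι → (Fin (k + 2) → ℝ) → X)
    (h : ∀ i ∈ s, p i ∈ PClass X m k a) : (fun z => ∑ i ∈ s, p i z) ∈ PClass X m k a := by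
  classical
  induction s using Finset.induction_on with
  | empty => simpa using zero_mem_PClass
  | insert i s hi ih =>
    simp only [Finset.sum_insert hi]
    exact add_mem_PClass (h i (Finset.mem_insert_self i s))
      (ih fun j hj => h j (Finset.mem_insert_of_mem hj))

theorem vpow_projVec {l : ℕ} (h : l ≤ k) (z : Fin (k + 2) → ℝ) (α : Fin (l + 2) → ℂ) :
    vpow (projVec l z) α
      = vpow z (fun i => if hi : (i : ℕ) < l + 2 then α ⟨i, hi⟩ else 0) := by
  unfold vpow
  have e : l + 2 ≤ k + 2 := by omega
  rw [← Finset.prod_subset (Finset.subset_univ (Finset.univ.map (Fin.castLEEmb e))),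
    Finset.prod_map]
  · refine Finset.prod_congr rfl fun i _ => ?_
    have hi : (i : ℕ) < k + 2 := by omega
    simp [projVec, hi]
    rfl
  · intro i _ hi
    have : ¬ (i : ℕ) < l + 2 := fun h' => hi (Finset.mem_map.2 ⟨⟨i, h'⟩, Finset.mem_univ _, rfl⟩)
    simp [this]

/-- The exponent is padded by zeros. Since `m ≤ l`, the padding lies beyond entry `m` and violates
neither constraint. -/
theorem comp_projVec_mem_PClass {l : ℕ} (hml : m ≤ l) (hlk : l ≤ k)
    {p : (Fin (l + 2) → ℝ) → X} (hp : p ∈ PClass X m l a) :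
    (fun z : Fin (k + 2) → ℝ => p (projVec l z)) ∈ PClass X m k a := by
  obtain ⟨S, ξ, hS, hp⟩ := hp
  refine mem_PClass_of_sum S
    (fun α i => if hi : (i : ℕ) < l + 2 then α ⟨i, hi⟩ else 0) ξ (fun α hα i => ?_) fun z hz => ?_
  · by_cases hi : (i : ℕ) < l + 2
    · simpa only [hi, dif_pos] using hS α hα ⟨i, hi⟩
    · simp only [hi, dif_neg, not_false_eq_true]
      exact ⟨fun _ => rfl, fun h => by omega⟩
  · rw [hp _ (projVec_mem_orthant l hz)]
    exact Finset.sum_congr rfl fun α _ => by rw [vpow_projVec hlk]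

theorem vpow_sum {ι : Type*} (s : Finset ι) {z : Fin (k + 2) → ℝ} (hz : z ∈ orthant k)
    (α : ι → Fin (k + 2) → ℂ) : vpow z (∑ i ∈ s, α i) = ∏ i ∈ s, vpow z (α i) := by
  unfold vpow
  rw [Finset.prod_comm]
  refine Finset.prod_congr rfl fun j _ => ?_
  have h : ((z j : ℝ) : ℂ) ≠ 0 := by exact_mod_cast (hz j).ne'
  simp only [Finset.sum_apply, Complex.cpow_def_of_ne_zero h, Finset.mul_sum, Complex.exp_sum]

/-- Multilinearity pulls out products of monomials, whose exponents add; the constraints on the real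
parts are additive. -/
theorem multilinear_mem_PClass {r : ℕ} (F : MultilinearMap ℂ (fun _ : Fin r => X) Y)
    (p : Fin r → (Fin (k + 2) → ℝ) → X) (b : Fin r → ℝ) (hp : ∀ i, p i ∈ PClass X m k (b i)) :
    (fun z => F fun i => p i z) ∈ PClass Y m k (∑ i, b i) := by
  classical
  choose S ξ hS hp using hp
  refine mem_PClass_of_sum (Fintype.piFinset S) (fun α => ∑ i, α i) (fun α => F fun i => ξ i (α i))
    (fun α hα j => ?_) fun z hz => ?_
  · rw [Fintype.mem_piFinset] at hα
    rw [Finset.sum_apply, Complex.re_sum]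
    exact ⟨fun h => Finset.sum_eq_zero fun i _ => (hS i _ (hα i) j).1 h,
      fun h => Finset.sum_congr rfl fun i _ => (hS i _ (hα i) j).2 h⟩
  · have e : (fun i => p i z) = fun i => ∑ β ∈ S i, vpow z β • ξ i β :=
      funext fun i => hp i z hz
    rw [e, F.map_sum_finset]
    refine Finset.sum_congr rfl fun α _ => ?_
    rw [F.map_smul_univ, vpow_sum _ hz]

end PClass

theorem PClass_isBigO {X : Type*} [NormedAddCommGroup X] [NormedSpace ℂ X] {m k : ℕ} (hmk : m ≤ k)
    {a : ℝ} {p : (Fin (k + 2) → ℝ) → X} (hp : p ∈ PClass X m k a) {ε : ℝ} (hε : 0 < ε) :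
    (fun t => p (Lhat k t)) =O[atTop] (fun t => iterLog m t ^ (a + ε)) := by
  obtain ⟨S, ξ, hS, hp⟩ := hp
  have h : (fun t => ∑ α ∈ S, vpow (Lhat k t) α • ξ α) =O[atTop]
      (fun t => iterLog m t ^ (a + ε)) := by
    refine IsBigO.fun_sum fun α hα => ?_
    have h1 := (vpow_Lhat_isBigO hmk (hS α hα) hε).smul (isBigO_refl (fun _ : ℝ => ξ α) atTop)
    refine h1.trans ?_
    refine IsBigO.of_bound ‖ξ α‖ (Eventually.of_forall fun t => ?_)
    rw [norm_smul, mul_comm]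
  refine h.congr' ?_ EventuallyEq.rfl
  filter_upwards [Lhat_mem_orthant k] with t ht using (hp _ ht).symm

/-! ### The operator `𝒵_A` -/

/-- `𝒵_A` changes coefficients but not exponents; `m ≥ 0` forces `Re α₋₁ = 0`, so its defining
formula applies. -/
theorem ZOp_mem_PClass {n : ℕ} (A : Matrix (Fin n) (Fin n) ℂ) {m : ℤ} (hm : 0 ≤ m) {k : ℕ} {a : ℝ}
    {p : (Fin (k + 2) → ℝ) → CVec n} (hp : p ∈ PClass (CVec n) m k a) :
    ZOp A k p ∈ PClass (CVec n) m k a := by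
  obtain ⟨S, ξ, hS, hp⟩ := hp
  exact ⟨S, _, hS, fun z _ => ZOp_eq A k p S ξ
    ⟨fun α hα i => ⟨fun h => by omega, fun h => (hS α hα i).1 (by omega)⟩, hp⟩ z⟩

/-- `-c` has nonpositive real part and is therefore no eigenvalue of `A`, so the inverse is genuine.
-/
theorem matVec_inv_shift {n : ℕ} (A : Matrix (Fin n) (Fin n) ℂ)
    (hA : ∀ l ∈ spectrum ℂ A, 0 < l.re) {c : ℂ} (hc : 0 ≤ c.re) (x : CVec n) :
    matVec A (matVec (A + c • (1 : Matrix (Fin n) (Fin n) ℂ))⁻¹ x)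
      + c • matVec (A + c • (1 : Matrix (Fin n) (Fin n) ℂ))⁻¹ x = x := by
  have hu : IsUnit (A + c • (1 : Matrix (Fin n) (Fin n) ℂ)) := by
    have h1 : -c ∉ spectrum ℂ A := fun h => by
      have := hA _ h
      rw [Complex.neg_re] at this
      linarith
    rw [spectrum.notMem_iff, Algebra.algebraMap_eq_smul_one, ← IsUnit.neg_iff] at h1
    convert h1 using 1
    rw [neg_smul]; abel
  have h2 := Matrix.mul_nonsing_inv _ ((Matrix.isUnit_iff_isUnit_det _).1 hu)
  set M := (A + c • (1 : Matrix (Fin n) (Fin n) ℂ))⁻¹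
  have h3 := congrArg (fun N => Matrix.toEuclideanCLM (𝕜 := ℂ) N x) h2
  simp only [map_mul, map_add, map_smul, map_one] at h3
  simpa [matVec_eq_toEuclideanCLM] using h3

/-- `u = 𝒵_A p` solves `u' = -A u + p` along `Lhat`, up to an error smaller than all powers. -/
theorem hasDerivAt_ZOp_Lhat {n : ℕ} (A : Matrix (Fin n) (Fin n) ℂ)
    (hA : ∀ l ∈ spectrum ℂ A, 0 < l.re) {m k : ℕ} (hm : 1 ≤ m) (hmk : m ≤ k) {a : ℝ}
    {p : (Fin (k + 2) → ℝ) → CVec n} (hp : p ∈ PClass (CVec n) m k a) :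
    ∃ e : ℝ → CVec n, (∀ M : ℝ, e =O[atTop] (fun t => iterLog m t ^ (-M))) ∧
      ∀ᶠ t in atTop, HasDerivAt (fun t => ZOp A k p (Lhat k t))
        (-(matVec A (ZOp A k p (Lhat k t))) + p (Lhat k t) + e t) t := by
  obtain ⟨S, ξ, hS, hp⟩ := hp
  have hS0 : ∀ α ∈ S, (α 0).re = 0 := fun α hα => (hS α hα 0).1 (by simp; omega)
  have hZ := ZOp_eq A k p S ξ
    ⟨fun α hα i => ⟨fun h => by omega, fun h => (hS α hα i).1 (by omega)⟩, hp⟩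
  set η : (Fin (k + 2) → ℂ) → CVec n := fun α =>
    matVec (A + (α 0) • (1 : Matrix (Fin n) (Fin n) ℂ))⁻¹ (ξ α) with hη
  refine ⟨fun t => ∑ α ∈ S, (vpow (Lhat k t) α * logPhaseCorr α t) • η α, fun M => ?_, ?_⟩
  · refine IsBigO.fun_sum fun α hα => ?_
    -- `z^α` is `O(L_m^{a+1})`; taking the power `-(M + (a + 1))` for the `O(1/t)` factor leaves
    -- exactly `-M`.
    have h1 := ((vpow_Lhat_isBigO hmk (hS α hα) one_pos).mul
      ((logPhaseCorr_isBigO α).trans (inv_isBigO_iterLog_rpow hm (M + (a + 1))))).trans_eventuallyEq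
      (iterLog_rpow_mul m _ _)
    have e : a + 1 + -(M + (a + 1)) = -M := by ring
    rw [e] at h1
    refine (h1.smul (isBigO_refl (fun _ : ℝ => η α) atTop)).trans ?_
    refine IsBigO.of_bound ‖η α‖ (Eventually.of_forall fun t => ?_)
    rw [norm_smul, mul_comm]
  · have hd : ∀ᶠ t in atTop, ∀ α ∈ S, HasDerivAt (fun t => vpow (Lhat k t) α)
        (vpow (Lhat k t) α * (α 0 + logPhaseCorr α t)) t :=
      (Finset.eventually_all S).2 fun α _ => hasDerivAt_vpow_Lhat α
    filter_upwards [hd, Lhat_mem_orthant k] with t h1 h2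
    have h3 : HasDerivAt (fun t => ∑ α ∈ S, vpow (Lhat k t) α • η α)
        (∑ α ∈ S, (vpow (Lhat k t) α * (α 0 + logPhaseCorr α t)) • η α) t :=
      HasDerivAt.fun_sum fun α hα => (h1 α hα).smul_const (η α)
    simp only [hZ]
    refine h3.congr_deriv ?_
    rw [hp _ h2]
    have h4 : matVec A (∑ α ∈ S, vpow (Lhat k t) α • η α)
        = ∑ α ∈ S, vpow (Lhat k t) α • (ξ α - α 0 • η α) := by
      simp only [matVec_eq_toEuclideanCLM, map_sum, map_smul]
      refine Finset.sum_congr rfl fun α hα => ?_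
      rw [← matVec_eq_toEuclideanCLM, eq_sub_of_add_eq (matVec_inv_shift A hA (hS0 α hα).ge (ξ α))]
    rw [h4]
    simp only [mul_add, add_smul, smul_sub, mul_smul, Finset.sum_add_distrib,
      Finset.sum_sub_distrib]
    abel

/-! ### Multilinear maps and homogeneous polynomials -/

theorem MultilinearMap.continuous_of_euclidean {n m : ℕ}
    (F : MultilinearMap ℂ (fun _ : Fin m => CVec n) (CVec n)) : Continuous F := by
  have h : (F : (Fin m → CVec n) → CVec n) = fun x =>
      ∑ r ∈ Fintype.piFinset (fun _ : Fin m => (Finset.univ : Finset (Fin n))),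
        (∏ i, x i (r i)) • F (fun i => EuclideanSpace.basisFun (Fin n) ℂ (r i)) := by
    funext x
    have e : x = fun i => ∑ j ∈ (Finset.univ : Finset (Fin n)),
        x i j • EuclideanSpace.basisFun (Fin n) ℂ j := by
      funext i
      exact ((EuclideanSpace.basisFun (Fin n) ℂ).sum_repr (x i)).symm
    conv_lhs => rw [e]
    rw [F.map_sum_finset]
    exact Finset.sum_congr rfl fun r _ => F.map_smul_univ _ _
  rw [h]
  fun_prop

/-- The difference of the values of a multilinear map on two diagonals. -/
theorem MultilinearMap.exists_diag_sub_bound {n m : ℕ}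
    (F : MultilinearMap ℂ (fun _ : Fin m => CVec n) (CVec n)) :
    ∃ c : ℝ, ∀ x y : CVec n, ‖F (fun _ => x) - F (fun _ => y)‖ ≤
      c * max ‖x‖ ‖y‖ ^ (m - 1) * ‖x - y‖ := by
  let F' : ContinuousMultilinearMap ℂ (fun _ : Fin m => CVec n) (CVec n) :=
    ⟨F, F.continuous_of_euclidean⟩
  refine ⟨‖F'‖ * m, fun x y => ?_⟩
  have h := F'.norm_image_sub_le (fun _ => x) (fun _ => y)
  rw [Fintype.card_fin] at h
  refine h.trans ?_
  have h1 : ‖(fun _ : Fin m => x)‖ ≤ ‖x‖ := pi_norm_const_le x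
  have h2 : ‖(fun _ : Fin m => y)‖ ≤ ‖y‖ := pi_norm_const_le y
  have h3 : ‖(fun _ : Fin m => x) - (fun _ : Fin m => y)‖ ≤ ‖x - y‖ := pi_norm_const_le (x - y)
  gcongr

/-- A monomial of degree `m` is a product of `m` variables. -/
theorem exists_enum_of_degree {n m : ℕ} (d : Fin n →₀ ℕ) (hd : d.degree = m) :
    ∃ idx : Fin m → Fin n, ∀ f : Fin n → ℂ, ∏ l, f (idx l) = ∏ i, f i ^ d i := by
  obtain ⟨w, hw⟩ := Quot.exists_rep d.toMultiset
  replace hw : (w : Multiset (Fin n)) = d.toMultiset := hw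
  have hlen : w.length = m := by
    rw [← Multiset.coe_card, hw, Finsupp.card_toMultiset, ← hd]; rfl
  subst hlen
  refine ⟨w.get, fun f => ?_⟩
  have h1 : (d.toMultiset.map f).prod = ∏ i, f i ^ d i := by
    rw [Finsupp.toMultiset_map, Finsupp.prod_toMultiset,
      Finsupp.prod_mapDomain_index (fun _ => pow_zero _) (fun _ _ _ => pow_add _ _ _),
      Finsupp.prod_fintype _ _ (fun _ => pow_zero _)]
  rw [← h1, ← hw, Multiset.map_coe, Multiset.prod_coe, ← List.prod_ofFn]
  change (List.ofFn (f ∘ w.get)).prod = _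
  rw [← List.map_ofFn, List.ofFn_get]

/-- Each monomial is written as a product of variables in a fixed order, one per slot. Only the
diagonal is prescribed, so no symmetrization is needed. -/
theorem exists_multilinear_of_isHomogeneous {n m : ℕ} (P : MvPolynomial (Fin n) ℂ)
    (hP : P.IsHomogeneous m) : ∃ F : MultilinearMap ℂ (fun _ : Fin m => CVec n) ℂ,
      ∀ x : CVec n, F (fun _ => x) = MvPolynomial.eval (fun j => x j) P := by
  have mono : ∀ d ∈ P.support, ∃ F : MultilinearMap ℂ (fun _ : Fin m => CVec n) ℂ,
      ∀ x : CVec n, F (fun _ => x) = P.coeff d * ∏ i, x i ^ d i := by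
    intro d hd
    obtain ⟨idx, hidx⟩ := exists_enum_of_degree d (m := m) (by
      rw [Finsupp.degree_eq_weight_one (R := ℕ)]
      exact hP (MvPolynomial.mem_support_iff.1 hd))
    refine ⟨P.coeff d • (MultilinearMap.mkPiAlgebra ℂ (Fin m) ℂ).compLinearMap fun l =>
      (EuclideanSpace.proj (𝕜 := ℂ) (ι := Fin n) (idx l)).toLinearMap, fun x => ?_⟩
    rw [← hidx]
    rfl
  choose! F hF using mono
  refine ⟨∑ d ∈ P.support, F d, fun x => ?_⟩
  rw [sum_apply, MvPolynomial.eval_eq']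
  exact Finset.sum_congr rfl fun d hd => hF d hd x

theorem IsHomogPoly.exists_multilinear {n m : ℕ} {g : CVec n → CVec n} (hg : IsHomogPoly m g) :
    ∃ F : MultilinearMap ℂ (fun _ : Fin m => CVec n) (CVec n), ∀ x, F (fun _ => x) = g x := by
  obtain ⟨P, hP, hg⟩ := hg
  choose F hF using fun i => exists_multilinear_of_isHomogeneous (P i) (hP i)
  refine ⟨∑ i, (F i).smulRight (EuclideanSpace.basisFun (Fin n) ℂ i), fun x => ?_⟩
  rw [sum_apply]
  simp only [MultilinearMap.smulRight_apply, hF, ← hg]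
  exact (EuclideanSpace.basisFun (Fin n) ℂ).sum_repr (g x)

/-! ### The recursion -/

/-- A tuple of length at least two has another entry, of positive weight, so each single weight is
strictly below the total. -/
theorem lt_of_mem_sumTuples {μ : ℕ → ℝ} (hpos : ∀ k, 0 < μ k) (hmono : StrictMono μ) {k : ℕ}
    {x : Σ m : ℕ, (Fin m → ℕ)} (hx : x ∈ sumTuples μ k) (i : Fin x.1) : x.2 i < k := by
  obtain ⟨h2, hsum⟩ := hx
  refine hmono.lt_iff_lt.1 ?_
  rw [← hsum]
  obtain ⟨j, hj⟩ : ∃ j : Fin x.1, j ≠ i := by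
    have : Nontrivial (Fin x.1) := Fin.nontrivial_iff_two_le.2 h2
    exact exists_ne i
  exact Finset.single_lt_sum hj (Finset.mem_univ i) (Finset.mem_univ j) (hpos _)
    fun _ _ _ => (hpos _).le

section Recursion

variable {n : ℕ} (A : Matrix (Fin n) (Fin n) ℂ)
  (𝒢 : (m : ℕ) → MultilinearMap ℂ (fun _ : Fin m => CVec n) (CVec n))
  (μ : ℕ → ℝ) (ν : ℕ → ℕ) (p : (k : ℕ) → (Fin (ν k + 2) → ℝ) → CVec n)

/-- The solution of the recursion. -/
noncomputable def recSolution (k : ℕ) : (Fin (ν k + 2) → ℝ) → CVec n :=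
  ZOp A (ν k) (fun z =>
    (∑ᶠ x ∈ sumTuples μ k, 𝒢 x.1 (fun i =>
      -- The guard serves well-founded recursion; on `sumTuples μ k` it always holds, so the value
      -- `0` is never used.
      if _ : x.2 i < k then recSolution (x.2 i) (projVec (ν (x.2 i)) z) else 0)) + p k z)
termination_by k

theorem isRecursive_recSolution (hpos : ∀ k, 0 < μ k) (hmono : StrictMono μ) :
    IsRecursive A 𝒢 μ ν p (recSolution A 𝒢 μ ν p) := by
  intro k z _
  conv_lhs => rw [recSolution]
  refine congrFun (congrArg (ZOp A (ν k)) (funext fun z => congrArg (· + p k z) ?_)) z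
  refine finsum_mem_congr rfl fun x hx => ?_
  congr 1
  funext i
  rw [dif_pos (lt_of_mem_sumTuples hpos hmono hx i)]

end Recursion

section RecursionClass

variable {n : ℕ} {A : Matrix (Fin n) (Fin n) ℂ}
  {𝒢 : (m : ℕ) → MultilinearMap ℂ (fun _ : Fin m => CVec n) (CVec n)}
  {μ : ℕ → ℝ} {ν : ℕ → ℕ} {p q : (k : ℕ) → (Fin (ν k + 2) → ℝ) → CVec n} {mstar : ℕ}

theorem tuple_term_mem_PClass (hpos : ∀ k, 0 < μ k) (hmono : StrictMono μ) (hνmono : Monotone ν)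
    (hνge : ∀ k, mstar ≤ ν k) {k : ℕ} {x : Σ m : ℕ, (Fin m → ℕ)} (hx : x ∈ sumTuples μ k)
    (hq : ∀ j < k, q j ∈ PClass (CVec n) mstar (ν j) (-μ j)) :
    (fun z => 𝒢 x.1 (fun i => q (x.2 i) (projVec (ν (x.2 i)) z)))
      ∈ PClass (CVec n) mstar (ν k) (-μ k) := by
  rw [← hx.2, ← Finset.sum_neg_distrib]
  refine multilinear_mem_PClass (𝒢 x.1) _ _ fun i => ?_
  have hlt := lt_of_mem_sumTuples hpos hmono hx i
  exact comp_projVec_mem_PClass (by exact_mod_cast hνge _) (hνmono hlt.le) (hq _ hlt)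

theorem recursion_source_mem_PClass (hpos : ∀ k, 0 < μ k) (hmono : StrictMono μ)
    (hνmono : Monotone ν) (hνge : ∀ k, mstar ≤ ν k) {k : ℕ}
    (hp : p k ∈ PClass (CVec n) mstar (ν k) (-μ k))
    (hq : ∀ j < k, q j ∈ PClass (CVec n) mstar (ν j) (-μ j)) :
    (fun z => (∑ᶠ x ∈ sumTuples μ k, 𝒢 x.1 (fun i => q (x.2 i) (projVec (ν (x.2 i)) z))) + p k z)
      ∈ PClass (CVec n) mstar (ν k) (-μ k) := by
  refine add_mem_PClass ?_ hp
  simp only [finsum_mem_eq_finite_toFinset_sum _ (sumTuples_finite μ hpos hmono k)]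
  refine sum_mem_PClass _ (fun (x : Σ m : ℕ, (Fin m → ℕ)) z => 𝒢 x.1 (fun i => q (x.2 i) (projVec (ν (x.2 i)) z)))
    fun x hx => ?_
  exact tuple_term_mem_PClass hpos hmono hνmono hνge ((Set.Finite.mem_toFinset _).1 hx) hq

theorem IsRecursive.mem_PClass (hrec : IsRecursive A 𝒢 μ ν p q) (hpos : ∀ k, 0 < μ k)
    (hmono : StrictMono μ) (hνmono : Monotone ν) (hνge : ∀ k, mstar ≤ ν k)
    (hp : ∀ k, p k ∈ PClass (CVec n) mstar (ν k) (-μ k)) (k : ℕ) :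
    q k ∈ PClass (CVec n) mstar (ν k) (-μ k) := by
  induction k using Nat.strong_induction_on with
  | _ k ih =>
    obtain ⟨S, ξ, hS, h⟩ := ZOp_mem_PClass A (Int.natCast_nonneg mstar)
      (recursion_source_mem_PClass (𝒢 := 𝒢) hpos hmono hνmono hνge (hp k) ih)
    exact ⟨S, ξ, hS, fun z hz => (hrec k hz).trans (h z hz)⟩

end RecursionClass

/-! ### The nonlinearity along decaying functions -/

/-- The difference carries `r - 1 ≥ 1` factors of order `a` besides `y - w`. One is kept as the
gain, the others are bounded. -/
theorem isBigO_diag_sub {n m r : ℕ} (hr : 2 ≤ r)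
    (F : MultilinearMap ℂ (fun _ : Fin r => CVec n) (CVec n)) {a b : ℝ} (ha : 0 ≤ a)
    {y w : ℝ → CVec n} (hy : y =O[atTop] fun t => iterLog m t ^ (-a))
    (hw : w =O[atTop] fun t => iterLog m t ^ (-a))
    (hyw : (fun t => y t - w t) =O[atTop] fun t => iterLog m t ^ (-b)) :
    (fun t => F (fun _ => y t) - F (fun _ => w t)) =O[atTop]
      fun t => iterLog m t ^ (-(b + a)) := by
  obtain ⟨c, hc⟩ := F.exists_diag_sub_bound
  have h1 : (fun t => max ‖y t‖ ‖w t‖) =O[atTop] fun t => iterLog m t ^ (-a) := by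
    refine IsBigO.trans (IsBigO.of_bound 1 (Eventually.of_forall fun t => ?_))
      (hy.norm_left.add hw.norm_left)
    rw [Real.norm_of_nonneg (by positivity), Real.norm_of_nonneg (by positivity), one_mul]
    exact max_le (by simp) (by simp)
  have h2 : (fun t => (iterLog m t ^ (-a)) ^ (r - 1)) =O[atTop] fun t => iterLog m t ^ (-a) := by
    refine IsBigO.of_bound 1 ?_
    filter_upwards [eventually_one_le_iterLog m] with t ht
    have h3 : 0 ≤ iterLog m t ^ (-a) := Real.rpow_nonneg (by linarith) _
    have h4 : iterLog m t ^ (-a) ≤ 1 := Real.rpow_le_one_of_one_le_of_nonpos ht (by linarith)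
    rw [Real.norm_of_nonneg (pow_nonneg h3 _), Real.norm_of_nonneg h3, one_mul]
    exact pow_le_of_le_one h3 h4 (by omega)
  have h5 := ((((h1.pow (r - 1)).trans h2).const_mul_left c).mul hyw.norm_left).trans_eventuallyEq
    (iterLog_rpow_mul m (-a) (-b))
  have e : -a + -b = -(b + a) := by ring
  rw [e] at h5
  refine IsBigO.trans (IsBigO.of_bound 1 (Eventually.of_forall fun t => ?_)) h5
  rw [one_mul]
  exact (hc _ _).trans (le_abs_self _)

theorem isBigO_diag_self {n r : ℕ} (hr : 0 < r)
    (F : MultilinearMap ℂ (fun _ : Fin r => CVec n) (CVec n)) :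
    (fun x => F fun _ => x) =O[𝓝 0] (fun x : CVec n => ‖x‖ ^ r) := by
  obtain ⟨c, hc⟩ := F.exists_diag_sub_bound
  refine IsBigO.of_bound c (Eventually.of_forall fun x => ?_)
  have h0 : F (fun _ => 0) = 0 := F.map_coord_zero ⟨0, hr⟩ rfl
  have h := hc x 0
  rw [h0, sub_zero, sub_zero, norm_zero, max_eq_left (norm_nonneg x), mul_assoc,
    ← pow_succ, Nat.sub_add_cancel hr] at h
  rwa [Real.norm_of_nonneg (by positivity)]

/-- The expansion at order two already gives `G(x) = O(|x|²)`. -/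
theorem HasPowerExpansion.isLittleO {n : ℕ} {G : CVec n → CVec n} {Gs : ℕ → CVec n → CVec n}
    (hG : HasPowerExpansion G Gs) (F : MultilinearMap ℂ (fun _ : Fin 2 => CVec n) (CVec n))
    (hF : ∀ x, F (fun _ => x) = Gs 2 x) : G =o[𝓝 0] (fun x => x) := by
  obtain ⟨δ, hδ, h⟩ := hG 2 le_rfl
  simp only [Finset.Icc_self, Finset.sum_singleton] at h
  have h1 : Gs 2 =O[𝓝 0] (fun x : CVec n => ‖x‖ ^ 2) := by
    have := isBigO_diag_self two_pos F
    simpa only [hF] using this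
  have h2 : (fun x : CVec n => ‖x‖ ^ (((2 : ℕ) : ℝ) + δ)) =O[𝓝 0] (fun x : CVec n => ‖x‖ ^ 2) := by
    refine IsBigO.of_bound 1 ?_
    filter_upwards [Metric.closedBall_mem_nhds (0 : CVec n) one_pos] with x hx
    rw [mem_closedBall_zero_iff] at hx
    rw [Real.norm_of_nonneg (by positivity), Real.norm_of_nonneg (by positivity), one_mul,
      ← Real.rpow_natCast]
    rcases (norm_nonneg x).eq_or_lt with h0 | h0
    · rw [← h0, Real.zero_rpow (by positivity)]; positivity
    · exact Real.rpow_le_rpow_of_exponent_ge h0 hx (by linarith)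
  have h3 : G =O[𝓝 0] (fun x : CVec n => ‖x‖ ^ 2) := by
    have := (h.trans h2).add h1
    simpa using this
  refine h3.trans_isLittleO ?_
  rw [← isLittleO_norm_right]
  have h4 : (fun x : CVec n => ‖x‖) =o[𝓝 0] (fun _ => (1 : ℝ)) := by
    rw [isLittleO_one_iff]
    simpa using (continuous_norm (E := CVec n)).tendsto 0
  have := h4.mul_isBigO (isBigO_refl (fun x : CVec n => ‖x‖) (𝓝 0))
  simpa [pow_two] using this

/-! ### Regrouping the sums over index tuples -/

theorem exists_eq_sum_of_preservesAdd {μ : ℕ → ℝ} (hadd : PreservesAdd (Set.range μ)) {r : ℕ}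
    (hr : 1 ≤ r) (j : Fin r → ℕ) : ∃ k, ∑ i, μ (j i) = μ k := by
  induction r, hr using Nat.le_induction with
  | base => exact ⟨j 0, by simp⟩
  | succ r _ ih =>
    obtain ⟨k, hk⟩ := ih fun i => j i.succ
    obtain ⟨l, hl⟩ := hadd _ ⟨j 0, rfl⟩ _ ⟨k, rfl⟩
    exact ⟨l, by rw [Fin.sum_univ_succ, hk, hl]⟩

/-- A multilinear expansion over all tuples with entries `< N` consists of the sums prescribed
by the recursion up to order `N` and of terms of higher order. -/
theorem sum_tuples_regroup {E : Type*} [AddCommGroup E] {μ : ℕ → ℝ} (hpos : ∀ k, 0 < μ k)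
    (hmono : StrictMono μ) (hadd : PreservesAdd (Set.range μ)) {N M : ℕ}
    (hM : μ N < M * μ 0) : ∃ T : Finset (Σ m : ℕ, (Fin m → ℕ)),
      (∀ x ∈ T, ∃ k, N < k ∧ x ∈ sumTuples μ k) ∧
      ∀ F : (Σ m : ℕ, (Fin m → ℕ)) → E,
        ∑ m ∈ Finset.Icc 2 M, ∑ j ∈ Fintype.piFinset (fun _ : Fin m => Finset.range N), F ⟨m, j⟩
          = ∑ k ∈ Finset.range (N + 1), ∑ᶠ x ∈ sumTuples μ k, F x + ∑ x ∈ T, F x := by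
  classical
  have hex : ∀ x : Σ m : ℕ, (Fin m → ℕ), 2 ≤ x.1 → ∃ k, ∑ i, μ (x.2 i) = μ k :=
    fun x hx => exists_eq_sum_of_preservesAdd hadd (by omega) x.2
  -- Closure under addition assigns to every tuple of length at least two the index `κ` of its
  -- weight.
  choose! κ hκ using hex
  set U : Finset (Σ m : ℕ, (Fin m → ℕ)) := (Finset.Icc 2 M).sigma
    fun m => Fintype.piFinset (fun _ : Fin m => Finset.range N) with hU
  have hmem : ∀ x ∈ U, x ∈ sumTuples μ (κ x) := by
    intro x hx
    have h2 := (Finset.mem_Icc.1 (Finset.mem_sigma.1 hx).1).1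
    exact ⟨h2, hκ x h2⟩
  -- For `k ≤ N` the truncation to `U` loses nothing: entries are below `k ≤ N`, and a tuple of
  -- length `m` has weight at least `m μ_0`, so `m < M`.
  have hset : ∀ k < N + 1, sumTuples μ k = ↑(U.filter fun x => κ x = k) := by
    intro k hk
    ext x
    simp only [Finset.coe_filter, Set.mem_ofPred_eq]
    constructor
    · intro hx
      refine ⟨Finset.mem_sigma.2 ⟨Finset.mem_Icc.2 ⟨hx.1, ?_⟩, Fintype.mem_piFinset.2 fun i => ?_⟩,
        hmono.injective ((hκ x hx.1).symm.trans hx.2)⟩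
      · have h1 : (x.1 : ℝ) * μ 0 ≤ μ k := by
          rw [← hx.2]
          calc (x.1 : ℝ) * μ 0 = ∑ _i : Fin x.1, μ 0 := by simp
            _ ≤ _ := Finset.sum_le_sum fun i _ => hmono.monotone (Nat.zero_le _)
        have h2 : μ k ≤ μ N := hmono.monotone (by omega)
        have h3 : (x.1 : ℝ) < M := lt_of_mul_lt_mul_right (by linarith) (hpos 0).le
        exact_mod_cast h3.le
      · have := lt_of_mem_sumTuples hpos hmono hx i
        exact Finset.mem_range.2 (by omega)
    · rintro ⟨hx, rfl⟩
      exact hmem x hx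
  refine ⟨U.filter fun x => ¬ κ x ∈ Finset.range (N + 1), fun x hx => ?_, fun F => ?_⟩
  · obtain ⟨h1, h2⟩ := Finset.mem_filter.1 hx
    exact ⟨κ x, by simpa using h2, hmem x h1⟩
  · rw [← Finset.sum_sigma (Finset.Icc 2 M)
      (fun m => Fintype.piFinset (fun _ : Fin m => Finset.range N)) F, ← hU,
      ← Finset.sum_filter_add_sum_filter_not U (fun x => κ x ∈ Finset.range (N + 1)),
      ← Finset.sum_fiberwise_eq_sum_filter]
    congr 1
    refine Finset.sum_congr rfl fun k hk => ?_
    rw [hset k (Finset.mem_range.1 hk), finsum_mem_coe_finset]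

/-! ### The expansion of the solution -/

/-- `G(y) = o(y)` is the admissible perturbation, and `f` is `O(L^{-a})` because its leading term
has order `μ_0` up to an arbitrarily small loss; hence `a < μ_0`. -/
theorem solution_isBigO_rpow {n : ℕ} (A : Matrix (Fin n) (Fin n) ℂ)
    (hA : ∀ l ∈ spectrum ℂ A, 0 < l.re) {G : CVec n → CVec n} (hG : G =o[𝓝 0] (fun x => x))
    {mstar : ℕ} {μ : ℕ → ℝ} {ν : ℕ → ℕ} (hνge : ∀ k, mstar ≤ ν k) {f : ℝ → CVec n}
    {fs : ℕ → ℝ → CVec n} (hfexp : HasLogExpansion mstar μ ν f fs) {y : ℝ → CVec n}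
    (hyode : ∀ᶠ t in atTop, HasDerivAt y (-(matVec A (y t)) + G (y t) + f t) t)
    (hylim : Tendsto y atTop (𝓝 0)) {a : ℝ} (ha : a < μ 0) :
    y =O[atTop] fun t => iterLog mstar t ^ (-a) := by
  obtain ⟨φ', hφ⟩ := iterLog_rpow_slow mstar (-a)
  refine isBigO_of_perturbed_ode A hA hφ hyode (hG.comp_tendsto hylim) ?_
  obtain ⟨p, hp, hfp⟩ := hfexp.1 0
  obtain ⟨b, hb, hfb⟩ := hfexp.2 0
  have h1 : fs 0 =O[atTop] fun t => iterLog mstar t ^ (-a) := by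
    have h2 := PClass_isBigO (hνge 0) hp (sub_pos.2 ha)
    have e : -μ 0 + (μ 0 - a) = -a := by ring
    rw [e] at h2
    refine h2.congr' ?_ EventuallyEq.rfl
    filter_upwards [eventually_gt_atTop (iterExp (ν 0) 0)] with t ht using (hfp t ht).symm
  have h3 := (hfb.trans (iterLog_rpow_isBigO mstar (show -b ≤ -a by linarith))).add h1
  simpa using h3

section Expansion

variable {n : ℕ} {A : Matrix (Fin n) (Fin n) ℂ}
  {𝒢 : (m : ℕ) → MultilinearMap ℂ (fun _ : Fin m => CVec n) (CVec n)}
  {μ : ℕ → ℝ} {ν : ℕ → ℕ} {p q : (k : ℕ) → (Fin (ν k + 2) → ℝ) → CVec n} {mstar : ℕ}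

/-- Each term of the expansion solves a linear equation up to a negligible error. -/
theorem IsRecursive.hasDerivAt (hrec : IsRecursive A 𝒢 μ ν p q)
    (hA : ∀ l ∈ spectrum ℂ A, 0 < l.re) (hmstar : 1 ≤ mstar) (hpos : ∀ k, 0 < μ k)
    (hmono : StrictMono μ) (hνmono : Monotone ν) (hνge : ∀ k, mstar ≤ ν k)
    (hp : ∀ k, p k ∈ PClass (CVec n) mstar (ν k) (-μ k)) (k : ℕ) :
    ∃ e : ℝ → CVec n, (∀ M : ℝ, e =O[atTop] (fun t => iterLog mstar t ^ (-M))) ∧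
      ∀ᶠ t in atTop, HasDerivAt (fun t => q k (Lhat (ν k) t))
        (-(matVec A (q k (Lhat (ν k) t))) +
          ((∑ᶠ x ∈ sumTuples μ k, 𝒢 x.1 (fun i => q (x.2 i) (Lhat (ν (x.2 i)) t)))
            + p k (Lhat (ν k) t)) + e t) t := by
  obtain ⟨e, he, hd⟩ := hasDerivAt_ZOp_Lhat A hA hmstar (hνge k)
    (recursion_source_mem_PClass (𝒢 := 𝒢) (q := q) hpos hmono hνmono hνge (hp k)
      fun j _ => hrec.mem_PClass hpos hmono hνmono hνge hp j)
  refine ⟨e, he, ?_⟩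
  -- The recursion holds only on the orthant; eventual equality, upgraded to neighbourhoods,
  -- transfers the derivative.
  have hq : ∀ᶠ t in atTop, q k (Lhat (ν k) t) = ZOp A (ν k) (fun z =>
      (∑ᶠ x ∈ sumTuples μ k, 𝒢 x.1 (fun i => q (x.2 i) (projVec (ν (x.2 i)) z))) + p k z)
      (Lhat (ν k) t) := by
    filter_upwards [Lhat_mem_orthant (ν k)] with t ht using hrec k ht
  filter_upwards [hd, eventually_mem_nhds_of_atTop hq] with t h1 h2
  have h3 : (∑ᶠ x ∈ sumTuples μ k, 𝒢 x.1 (fun i => q (x.2 i) (Lhat (ν (x.2 i)) t)))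
      = ∑ᶠ x ∈ sumTuples μ k, 𝒢 x.1 (fun i => q (x.2 i) (projVec (ν (x.2 i)) (Lhat (ν k) t))) := by
    refine finsum_mem_congr rfl fun x hx => ?_
    congr 1
    funext i
    rw [projVec_Lhat (hνmono (lt_of_mem_sumTuples hpos hmono hx i).le)]
  rw [h3, h2.self_of_nhds]
  exact h1.congr_of_eventuallyEq h2

theorem tuple_term_isBigO (hpos : ∀ k, 0 < μ k) (hmono : StrictMono μ) (hνmono : Monotone ν)
    (hνge : ∀ k, mstar ≤ ν k) (hq : ∀ k, q k ∈ PClass (CVec n) mstar (ν k) (-μ k)) {k : ℕ}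
    {x : Σ m : ℕ, (Fin m → ℕ)} (hx : x ∈ sumTuples μ k) {ε : ℝ} (hε : 0 < ε) :
    (fun t => 𝒢 x.1 (fun i => q (x.2 i) (Lhat (ν (x.2 i)) t)))
      =O[atTop] fun t => iterLog mstar t ^ (-μ k + ε) := by
  have h := PClass_isBigO (hνge k)
    (tuple_term_mem_PClass (𝒢 := 𝒢) hpos hmono hνmono hνge hx fun j _ => hq j) hε
  refine h.congr_left fun t => ?_
  congr 1
  funext i
  rw [projVec_Lhat (hνmono (lt_of_mem_sumTuples hpos hmono hx i).le)]

/-- One step of the expansion: a remainder of order `b` with `μ_N < b + μ_0` before the `N`-th term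
gives a remainder of order better than `μ_N` after it. -/
theorem expansion_step (hA : ∀ l ∈ spectrum ℂ A, 0 < l.re)
    {G : CVec n → CVec n} {Gs : ℕ → CVec n → CVec n} (hGexp : HasPowerExpansion G Gs)
    (h𝒢 : ∀ m, 2 ≤ m → ∀ x, 𝒢 m (fun _ => x) = Gs m x)
    {f : ℝ → CVec n} {fs : ℕ → ℝ → CVec n} (hmstar : 1 ≤ mstar) (hpos : ∀ k, 0 < μ k)
    (hmono : StrictMono μ) (hadd : PreservesAdd (Set.range μ)) (hνmono : Monotone ν)
    (hνge : ∀ k, mstar ≤ ν k) (hfexp : HasLogExpansion mstar μ ν f fs)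
    (hp : ∀ k, p k ∈ PClass (CVec n) mstar (ν k) (-μ k))
    (hfs : ∀ k t, iterExp (ν k) 0 < t → fs k t = p k (Lhat (ν k) t))
    (hrec : IsRecursive A 𝒢 μ ν p q) {y : ℝ → CVec n}
    (hyode : ∀ᶠ t in atTop, HasDerivAt y (-(matVec A (y t)) + G (y t) + f t) t)
    (hylim : Tendsto y atTop (𝓝 0)) {N : ℕ} {b : ℝ} (hb : μ N < b + μ 0)
    (hv : (fun t => y t - ∑ k ∈ Finset.range N, q k (Lhat (ν k) t))
      =O[atTop] fun t => iterLog mstar t ^ (-b)) :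
    ∃ b' : ℝ, μ N < b' ∧ (fun t => y t - ∑ k ∈ Finset.range (N + 1), q k (Lhat (ν k) t))
      =O[atTop] fun t => iterLog mstar t ^ (-b') := by
  have hq := hrec.mem_PClass hpos hmono hνmono hνge hp
  -- `a` is an available decay rate of `y`, close enough to `μ_0` that `b + a > μ_N`. Then `M` is
  -- taken so large that the tail of `G`, of order `M a`, also beats `μ_N`.
  obtain ⟨a, ha, haμ⟩ := exists_between (max_lt (show μ N - b < μ 0 by linarith) (hpos 0))
  have ha0 : 0 < a := (le_max_right _ _).trans_lt ha
  have hab : μ N < b + a := by linarith [(le_max_left (μ N - b) 0).trans_lt ha]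
  obtain ⟨M, hMa, hM2⟩ : ∃ M : ℕ, μ N < M * a ∧ 2 ≤ M := by
    obtain ⟨M, hM⟩ := exists_nat_gt (μ N / a)
    refine ⟨max M 2, ?_, le_max_right _ _⟩
    rw [div_lt_iff₀ ha0] at hM
    refine hM.trans_le (mul_le_mul_of_nonneg_right ?_ ha0.le)
    exact_mod_cast le_max_left M 2
  have hMμ : μ N < M * μ 0 :=
    hMa.trans_le (mul_le_mul_of_nonneg_left haμ.le (Nat.cast_nonneg M))
  obtain ⟨T, hT, hregroup⟩ := sum_tuples_regroup (E := CVec n) hpos hmono hadd hMμ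
  obtain ⟨δ, hδ, hGδ⟩ := hGexp M hM2
  obtain ⟨bf, hbf, hff⟩ := hfexp.2 N
  choose e he hde using hrec.hasDerivAt hA hmstar hpos hmono hνmono hνge hp
  have hNN : μ N < μ (N + 1) := hmono (Nat.lt_succ_self N)
  set ε : ℝ := (μ (N + 1) - μ N) / 2 with hε
  have hε0 : 0 < ε := by rw [hε]; linarith
  -- The four entries are the orders of the tail of `G`, of replacing `y` by `W`, of tuples of
  -- weight at least `μ_{N+1}` (`ε` is half the gap), and of the remainder of `f`.
  set b' : ℝ := min (min (M * a) (b + a)) (min (μ N + ε) bf) with hb'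
  have hb'1 : b' ≤ M * a := (min_le_left _ _).trans (min_le_left _ _)
  have hb'2 : b' ≤ b + a := (min_le_left _ _).trans (min_le_right _ _)
  have hb'3 : b' ≤ μ N + ε := (min_le_right _ _).trans (min_le_left _ _)
  have hb'4 : b' ≤ bf := (min_le_right _ _).trans (min_le_right _ _)
  have hb'N : μ N < b' := lt_min (lt_min hMa hab) (lt_min (by linarith) hbf)
  refine ⟨b', hb'N, ?_⟩
  set Y : ℕ → ℝ → CVec n := fun k t => q k (Lhat (ν k) t) with hY
  -- `W` stops before `N` because the recursion sources up to index `N` involve only smaller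
  -- indices; the hypothesis `hv` bounds exactly `y - W`.
  set W : ℝ → CVec n := fun t => ∑ k ∈ Finset.range N, Y k t with hW
  set F : (Σ m : ℕ, (Fin m → ℕ)) → ℝ → CVec n := fun x t => 𝒢 x.1 (fun i => Y (x.2 i) t) with hF
  have hG0 := hGexp.isLittleO (𝒢 2) (h𝒢 2 le_rfl)
  have hya : y =O[atTop] fun t => iterLog mstar t ^ (-a) :=
    solution_isBigO_rpow A hA hG0 hνge hfexp hyode hylim haμ
  have hWa : W =O[atTop] fun t => iterLog mstar t ^ (-a) := by
    refine IsBigO.fun_sum fun k _ => ?_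
    have h1 := PClass_isBigO (hνge k) (hq k) (sub_pos.2 haμ)
    have h2 : μ 0 ≤ μ k := hmono.monotone (Nat.zero_le k)
    exact h1.trans (iterLog_rpow_isBigO mstar (by linarith))
  have hR1 : (fun t => G (y t) - ∑ m ∈ Finset.Icc 2 M, Gs m (y t))
      =O[atTop] fun t => iterLog mstar t ^ (-b') := by
    have h1 := hGδ.comp_tendsto hylim
    have h2 : (fun t => ‖y t‖ ^ ((M : ℝ) + δ)) =O[atTop]
        fun t => (iterLog mstar t ^ (-a)) ^ ((M : ℝ) + δ) := by
      refine IsBigO.rpow (by positivity) ?_ hya.norm_left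
      filter_upwards [eventually_one_le_iterLog mstar] with t ht
      exact Real.rpow_nonneg (by linarith) _
    have h3 : (fun t => (iterLog mstar t ^ (-a)) ^ ((M : ℝ) + δ))
        =ᶠ[atTop] fun t => iterLog mstar t ^ (-a * ((M : ℝ) + δ)) := by
      filter_upwards [eventually_one_le_iterLog mstar] with t ht
      rw [← Real.rpow_mul (by linarith)]
    refine (h1.trans (h2.trans_eventuallyEq h3)).trans (iterLog_rpow_isBigO mstar ?_)
    nlinarith [mul_pos ha0 hδ]
  have hR2 : (fun t => ∑ m ∈ Finset.Icc 2 M, (𝒢 m (fun _ => y t) - 𝒢 m (fun _ => W t)))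
      =O[atTop] fun t => iterLog mstar t ^ (-b') := by
    refine IsBigO.fun_sum fun m hm => ?_
    exact (isBigO_diag_sub (Finset.mem_Icc.1 hm).1 (𝒢 m) ha0.le hya hWa hv).trans
      (iterLog_rpow_isBigO mstar (by linarith))
  have hR3 : (fun t => ∑ x ∈ T, F x t) =O[atTop] fun t => iterLog mstar t ^ (-b') := by
    refine IsBigO.fun_sum fun x hx => ?_
    obtain ⟨k, hk, hxk⟩ := hT x hx
    refine (tuple_term_isBigO hpos hmono hνmono hνge hq hxk hε0).trans
      (iterLog_rpow_isBigO mstar ?_)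
    have : μ (N + 1) ≤ μ k := hmono.monotone hk
    have h2ε : μ (N + 1) = μ N + 2 * ε := by rw [hε]; ring
    linarith
  have hR4 : (fun t => f t - ∑ k ∈ Finset.range (N + 1), fs k t)
      =O[atTop] fun t => iterLog mstar t ^ (-b') :=
    hff.trans (iterLog_rpow_isBigO mstar (by linarith))
  have hR5 : (fun t => ∑ k ∈ Finset.range (N + 1), e k t)
      =O[atTop] fun t => iterLog mstar t ^ (-b') := IsBigO.fun_sum fun k _ => he k b'
  have hexpand : ∀ t, ∑ m ∈ Finset.Icc 2 M, 𝒢 m (fun _ => W t)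
      = ∑ k ∈ Finset.range (N + 1), ∑ᶠ x ∈ sumTuples μ k, F x t + ∑ x ∈ T, F x t := by
    intro t
    rw [← hregroup fun x => F x t]
    exact Finset.sum_congr rfl fun m _ => (𝒢 m).map_sum_finset (fun _ k => Y k t) _
  obtain ⟨φ', hφ⟩ := iterLog_rpow_slow mstar (-b')
  -- The sources in the equations of the `q_k` cancel against the expansion of `G(W)` and the terms
  -- of `f`. The new remainder solves a linear equation forced by the five errors alone, with `H =
  -- 0`.
  refine isBigO_of_perturbed_ode A hA hφ (H := fun _ => 0) ?_ (isLittleO_zero _ _)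
    ((((hR1.add hR2).add hR3).add hR4).sub hR5)
  have hfs' : ∀ᶠ t in atTop, ∀ k ∈ Finset.range (N + 1), p k (Lhat (ν k) t) = fs k t := by
    refine (Finset.eventually_all _).2 fun k _ => ?_
    filter_upwards [eventually_gt_atTop (iterExp (ν k) 0)] with t ht using (hfs k t ht).symm
  have hd := (Finset.eventually_all (Finset.range (N + 1))).2 fun k _ => hde k
  filter_upwards [hyode, hd, hfs'] with t h1 h2 h3
  refine (h1.sub (HasDerivAt.fun_sum h2)).congr_deriv ?_
  have h4 : ∑ m ∈ Finset.Icc 2 M, Gs m (y t) = ∑ m ∈ Finset.Icc 2 M, 𝒢 m (fun _ => y t) :=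
    Finset.sum_congr rfl fun m hm => (h𝒢 m (Finset.mem_Icc.1 hm).1 _).symm
  have h5 : ∑ k ∈ Finset.range (N + 1), p k (Lhat (ν k) t)
      = ∑ k ∈ Finset.range (N + 1), fs k t := Finset.sum_congr rfl h3
  have h6 : matVec A (y t - ∑ k ∈ Finset.range (N + 1), Y k t)
      = matVec A (y t) - ∑ k ∈ Finset.range (N + 1), matVec A (Y k t) := by
    simp only [matVec_eq_toEuclideanCLM, map_sub, map_sum]
  rw [h4, h6]
  simp only [Finset.sum_add_distrib, Finset.sum_sub_distrib, Finset.sum_neg_distrib]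
  rw [h5, hexpand]
  abel

end Expansion

/-! ### Induction on the order of the expansion, and the main theorem. -/

theorem recursion_expansion {n : ℕ}
    {A : Matrix (Fin n) (Fin n) ℂ} (hA : ∀ l ∈ spectrum ℂ A, 0 < l.re)
    {G : CVec n → CVec n} {Gs : ℕ → CVec n → CVec n} (hGexp : HasPowerExpansion G Gs)
    {f : ℝ → CVec n} {mstar : ℕ} (hmstar : 1 ≤ mstar)
    {μ : ℕ → ℝ} (hμpos : ∀ k, 0 < μ k) (hμmono : StrictMono μ)
    (hμadd : PreservesAdd (Set.range μ))
    {ν : ℕ → ℕ} (hνmono : Monotone ν) (hνge : ∀ k, mstar ≤ ν k)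
    {fs : ℕ → ℝ → CVec n} (hfexp : HasLogExpansion mstar μ ν f fs) {y : ℝ → CVec n}
    (hyode : ∀ᶠ t in atTop, HasDerivAt y (-(matVec A (y t)) + G (y t) + f t) t)
    (hylim : Tendsto y atTop (𝓝 0))
    {𝒢 : (m : ℕ) → MultilinearMap ℂ (fun _ : Fin m => CVec n) (CVec n)}
    (h𝒢 : ∀ m, 2 ≤ m → ∀ x, 𝒢 m (fun _ => x) = Gs m x)
    {p q : (k : ℕ) → (Fin (ν k + 2) → ℝ) → CVec n}
    (hp : ∀ k, p k ∈ PClass (CVec n) (mstar : ℤ) (ν k) (-μ k))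
    (hfs : ∀ k t, iterExp (ν k) 0 < t → fs k t = p k (Lhat (ν k) t))
    (hrec : IsRecursive A 𝒢 μ ν p q) :
    HasLogExpansion mstar μ ν y (fun k t => q k (Lhat (ν k) t)) := by
  refine ⟨fun k => ⟨q k, hrec.mem_PClass hμpos hμmono hνmono hνge hp k, fun _ _ => rfl⟩,
    fun N => ?_⟩
  have step := @expansion_step n A 𝒢 μ ν p q mstar hA G Gs hGexp h𝒢 f fs hmstar hμpos hμmono hμadd
    hνmono hνge hfexp hp hfs hrec y hyode hylim
  induction N with
  | zero =>
    -- The sum before the term `0` is empty, so the required bound is the a priori decay of `y`; any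
    -- order in `(0, μ_0)` would do.
    refine step (b := μ 0 / 2) (by linarith [hμpos 0]) ?_
    simpa using solution_isBigO_rpow A hA (hGexp.isLittleO (𝒢 2) (h𝒢 2 le_rfl)) hνge hfexp hyode
      hylim (half_lt_self (hμpos 0))
  | succ N ih =>
    obtain ⟨b, hb, h⟩ := ih
    refine step (b := b) ?_ h
    -- `μ_N + μ_0` is itself some `μ_l` with `l > N`, so `μ_{N+1} ≤ μ_N + μ_0 < b + μ_0`, as the
    -- step requires.
    obtain ⟨l, hl⟩ := hμadd _ ⟨N, rfl⟩ _ ⟨0, rfl⟩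
    have h1 : N < l := hμmono.lt_iff_lt.1 (by rw [hl]; linarith [hμpos 0])
    have h2 : μ (N + 1) ≤ μ l := hμmono.monotone h1
    linarith

theorem theorem9p2 (n : ℕ)
    -- the matrix: all eigenvalues have positive real parts
    (A : Matrix (Fin n) (Fin n) ℂ) (hA : ∀ l ∈ spectrum ℂ A, 0 < l.re)
    -- the nonlinearity: locally Lipschitz, with an expansion into homogeneous polynomials at 0
    (G : CVec n → CVec n) (hG : LocallyLipschitz G)
    (Gs : ℕ → CVec n → CVec n) (hGs : ∀ m, 2 ≤ m → IsHomogPoly m (Gs m))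
    (hGexp : HasPowerExpansion G Gs)
    -- the forcing function: continuous on some half-line, with a log-type expansion
    (f : ℝ → CVec n) (hf : ∃ Tf : ℝ, 0 ≤ Tf ∧ ContinuousOn f (Set.Ici Tf))
    (mstar : ℕ) (hmstar : 1 ≤ mstar)
    (μ : ℕ → ℝ) (hμpos : ∀ k, 0 < μ k) (hμmono : StrictMono μ) (hμdiv : Tendsto μ atTop atTop)
    (hμadd : PreservesAdd (Set.range μ))
    (ν : ℕ → ℕ) (hνmono : Monotone ν) (hνge : ∀ k, mstar ≤ ν k)
    (fs : ℕ → ℝ → CVec n) (hfexp : HasLogExpansion mstar μ ν f fs)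
    -- the decaying solution
    (y : ℝ → CVec n) (T₀ : ℝ) (hT₀ : 0 ≤ T₀) (hyC1 : ContDiffOn ℝ 1 y (Set.Ioi T₀))
    (hyode : ∀ t, T₀ < t → HasDerivAt y (-(matVec A (y t)) + G (y t) + f t) t)
    (hylim : Tendsto y atTop (𝓝 0)) :
    (∃ ys : ℕ → ℝ → CVec n, HasLogExpansion mstar μ ν y ys) ∧
    (∀ 𝒢 : (m : ℕ) → MultilinearMap ℂ (fun _ : Fin m => CVec n) (CVec n),
      (∀ m, 2 ≤ m → ∀ x, 𝒢 m (fun _ => x) = Gs m x) →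
      ∀ p : (k : ℕ) → (Fin (ν k + 2) → ℝ) → CVec n,
        (∀ k, p k ∈ PClass (CVec n) (mstar : ℤ) (ν k) (-μ k)) →
        (∀ k t, iterExp (ν k) 0 < t → fs k t = p k (Lhat (ν k) t)) →
        (∃ q : (k : ℕ) → (Fin (ν k + 2) → ℝ) → CVec n, IsRecursive A 𝒢 μ ν p q) ∧
        ∀ q : (k : ℕ) → (Fin (ν k + 2) → ℝ) → CVec n, IsRecursive A 𝒢 μ ν p q →
          (∀ k, q k ∈ PClass (CVec n) (mstar : ℤ) (ν k) (-μ k)) ∧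
          HasLogExpansion mstar μ ν y (fun k t => q k (Lhat (ν k) t))) := by
  have hode : ∀ᶠ t in atTop, HasDerivAt y (-(matVec A (y t)) + G (y t) + f t) t := by
    filter_upwards [eventually_gt_atTop T₀] with t ht using hyode t ht
  have main : ∀ 𝒢 : (m : ℕ) → MultilinearMap ℂ (fun _ : Fin m => CVec n) (CVec n),
      (∀ m, 2 ≤ m → ∀ x, 𝒢 m (fun _ => x) = Gs m x) →
      ∀ p : (k : ℕ) → (Fin (ν k + 2) → ℝ) → CVec n,
        (∀ k, p k ∈ PClass (CVec n) (mstar : ℤ) (ν k) (-μ k)) →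
        (∀ k t, iterExp (ν k) 0 < t → fs k t = p k (Lhat (ν k) t)) →
        ∀ q : (k : ℕ) → (Fin (ν k + 2) → ℝ) → CVec n, IsRecursive A 𝒢 μ ν p q →
          HasLogExpansion mstar μ ν y (fun k t => q k (Lhat (ν k) t)) :=
    fun 𝒢 h𝒢 p hp hfs q hrec => recursion_expansion hA hGexp hmstar hμpos hμmono hμadd hνmono hνge
      hfexp hode hylim h𝒢 hp hfs hrec
  refine ⟨?_, fun 𝒢 h𝒢 p hp hfs => ⟨⟨_, isRecursive_recSolution A 𝒢 μ ν p hμpos hμmono⟩,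
    fun q hrec => ⟨hrec.mem_PClass hμpos hμmono hνmono hνge hp, main 𝒢 h𝒢 p hp hfs q hrec⟩⟩⟩
  -- Bare existence follows by choosing some multilinear representatives and some representatives
  -- `p_k` of the forcing terms; degrees below two receive the dummy value `0`.
  have hex : ∀ m, ∃ F : MultilinearMap ℂ (fun _ : Fin m => CVec n) (CVec n),
      2 ≤ m → ∀ x, F (fun _ => x) = Gs m x := by
    intro m
    by_cases hm : 2 ≤ m
    · obtain ⟨F, hF⟩ := (hGs m hm).exists_multilinear
      exact ⟨F, fun _ => hF⟩
    · exact ⟨0, fun h => absurd h hm⟩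
  choose 𝒢 h𝒢 using hex
  choose p hp hfs using hfexp.1
  exact ⟨_, main 𝒢 h𝒢 p hp hfs _ (isRecursive_recSolution A 𝒢 μ ν p hμpos hμmono)⟩
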